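/- Let $r\ge 2$ and $d\ge 1$ be integers, and let $S_n\subset\mathbb{C}[x]$ be the space of polynomials of degree at most $n$ (with $S_0=\mathbb C$). Put $d_{11}=d$, $d_{1j}=d+1$, $d_{i1}=d-1$, $d_{ij}=d$ for $2\le i,j\le r$, and let $M'=M'(r,d)$ be the affine space of $r\times r$ matrices $A(x)$ with entries $A_{ij}(x)=\sum_{k=0}^{d_{ij}}A_{ij;k}x^k\in S_{d_{ij}}$. Let $G_r$ be the group of matrices $$g(x)=\begin{pmatrix}1&{}^t\vec b_1x+{}^t\vec b_0\\0&B\end{pmatrix},\qquad B\in GL_{r-1}(\mathbb{C}),\ \vec b_0,\vec b_1\in\mathbb{C}^{r-1},$$ acting on $M'$ by $A(x)\mapsto g(x)^{-1}A(x)g(x)$. For $\phi\in S_{d+2}$ let $\{\cdot,\cdot\}^{BV}_\phi$ be the bracket on regular functions on Zariski open subsets of $M'$ which is a biderivation and is given on the coordinate functions by $$\{A_{ij}(x),A_{kl}(y)\}^{BV}_\phi=\Big[\delta_{i,l}\frac{A_{kj}(x)\phi(y)-\phi(x)A_{kj}(y)}{x-y}-\delta_{k,j}\frac{A_{il}(x)\phi(y)-\phi(x)A_{il}(y)}{x-y}\Big]_{\le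 d_{ij},\,\le d_{kl}},$$ where $[\cdot]_{\le m,\le n}$ keeps the terms of degree at most $m$ in $x$ and at most $n$ in $y$. (1) For every $\phi\in S_{d+2}$ the sheaf $\mathcal{O}_{M'}^{G_r}$ of $G_r$-invariant regular functions on $M'$ is closed under $\{\cdot,\cdot\}^{BV}_\phi$, and $\{\cdot,\cdot\}^{BV}_\phi$ is a Poisson algebra structure on $\mathcal{O}_{M'}^{G_r}$: it is $\mathbb{C}$-bilinear, compatible with restrictions, skew-symmetric, and satisfies the Leibniz rule and the Jacobi identity. (2) Let $M'_{ir}\subset M'$ be the set of $A(x)$ whose spectral curve $\det(y\mathbb{I}_r-A(x))=0$ is irreducible (that is, $\det(y\mathbb{I}_r-A(x))$ is an irreducible polynomial in $\mathbb{C}[x,y]$), and let $\eta':M'_{ir}\to\mathcal{M}'(r,d)=M'_{ir}/G_r$ be the quotient map, where $\mathcal{M}'(r,d)$ carries the quotient of the Zariski topology and the sheaf of functions whose pullback by $\eta'$ is regular. Then for every $\phi\in S_{d+2}$ the bracket $\{\cdot,\cdot\}^{BV}_\phi$ induces a Poisson structure $\{\cdot,\cdot\}'_\phi$ on $\mathcal{M}'(r,d)$,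 determined by $\eta'^*\{f,h\}'_\phi=\{\eta'^*f,\eta'^*h\}^{BV}_\phi$. These Poisson structures are compatible: $$\{\cdot,\cdot\}'_{c_1\phi_1+c_2\phi_2}=c_1\{\cdot,\cdot\}'_{\phi_1}+c_2\{\cdot,\cdot\}'_{\phi_2}\qquad(c_1,c_2\in\mathbb{C},\ \phi_1,\phi_2\in S_{d+2}).$$ -/

import Mathlib

noncomputable section

namespace BV

open Polynomial TopologicalSpace

/-! ### Sheaves of functions and Poisson algebra structures on them -/

/-- A sheaf of `ℂ`-algebras of complex valued functions on `X`: for every open `U` an algebra of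
functions on `U`, stable under restriction and such that membership can be checked locally. -/
structure FunctionSheaf (X : Type*) [TopologicalSpace X] where
  sections : ∀ U : Opens X, Subalgebra ℂ (U → ℂ)
  restrict_mem : ∀ {U V : Opens X} (h : V ≤ U) (f : U → ℂ), f ∈ sections U →
    (fun a : V => f ⟨a.1, h a.2⟩) ∈ sections V
  locality : ∀ {U : Opens X} (f : U → ℂ),
    (∀ a : U, ∃ (V : Opens X) (h : V ≤ U), a.1 ∈ V ∧
      (fun b : V => f ⟨b.1, h b.2⟩) ∈ sections V) → f ∈ sections U

namespace FunctionSheaf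

variable {X : Type*} [TopologicalSpace X]

/-- The restriction map `F(U) → F(V)` for `V ⊆ U`. -/
def res (F : FunctionSheaf X) {U V : Opens X} (h : V ≤ U) (f : F.sections U) : F.sections V :=
  ⟨fun a => f.1 ⟨a.1, h a.2⟩, F.restrict_mem h f.1 f.2⟩

/-- The sheaf induced on a subset `S`: functions that are locally restrictions of sections of `F`
on open subsets of `X`. For open `S` this is the usual restriction of `F` to `S`. -/
def induced (F : FunctionSheaf X) (S : Set X) : FunctionSheaf S where
  sections V :=
    { carrier := {f | ∀ a : V, ∃ (W : Opens X) (s : W → ℂ), s ∈ F.sections W ∧ a.1.1 ∈ W ∧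
        ∀ (b : V) (hb : b.1.1 ∈ W), f b = s ⟨b.1.1, hb⟩}
      mul_mem' := by
        intro f g hf hg a
        obtain ⟨W, s, hs, haW, hfs⟩ := hf a
        obtain ⟨W', s', hs', haW', hfs'⟩ := hg a
        refine ⟨W ⊓ W', _, (F.sections _).mul_mem (F.restrict_mem inf_le_left s hs)
          (F.restrict_mem inf_le_right s' hs'), ⟨haW, haW'⟩, ?_⟩
        intro b hb
        simp [hfs b hb.1, hfs' b hb.2]
      add_mem' := by
        intro f g hf hg a
        obtain ⟨W, s, hs, haW, hfs⟩ := hf a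
        obtain ⟨W', s', hs', haW', hfs'⟩ := hg a
        refine ⟨W ⊓ W', _, (F.sections _).add_mem (F.restrict_mem inf_le_left s hs)
          (F.restrict_mem inf_le_right s' hs'), ⟨haW, haW'⟩, ?_⟩
        intro b hb
        simp [hfs b hb.1, hfs' b hb.2]
      algebraMap_mem' := by
        intro c a
        exact ⟨⊤, _, (F.sections ⊤).algebraMap_mem c, trivial, fun b hb => rfl⟩ }
  restrict_mem := by
    intro U V h f hf a
    obtain ⟨W, s, hs, haW, hfs⟩ := hf ⟨a.1, h a.2⟩
    exact ⟨W, s, hs, haW, fun b hb => hfs ⟨b.1, h b.2⟩ hb⟩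
  locality := by
    intro U f hf a
    obtain ⟨V, h, haV, hfV⟩ := hf a
    obtain ⟨W, s, hs, haW, hfs⟩ := hfV ⟨a.1, haV⟩
    obtain ⟨V', hV', hVV⟩ := isOpen_induced_iff.1 V.2
    have key : ∀ x : S, x.1 ∈ V' ↔ x ∈ V := fun x => by
      change x ∈ Subtype.val ⁻¹' V' ↔ _
      rw [hVV]; rfl
    refine ⟨W ⊓ ⟨V', hV'⟩, _, F.restrict_mem inf_le_left s hs, ⟨haW, (key _).2 haV⟩, ?_⟩
    intro b hb
    exact hfs ⟨b.1, (key _).1 hb.2⟩ hb.1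

/-- The sheaf on a quotient space: functions on an open `V` whose pullback to the preimage
of `V` is a section of `F`. -/
def quotient (F : FunctionSheaf X) (s : Setoid X) : FunctionSheaf (Quotient s) where
  sections V :=
    { carrier := {f | (fun a : V.comap ⟨Quotient.mk s, continuous_quotient_mk'⟩ =>
        f ⟨Quotient.mk s a.1, a.2⟩) ∈ F.sections _}
      mul_mem' := fun hf hg => (F.sections _).mul_mem hf hg
      add_mem' := fun hf hg => (F.sections _).add_mem hf hg
      algebraMap_mem' := fun c => (F.sections _).algebraMap_mem c }
  restrict_mem := fun {U V} h f hf =>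
    F.restrict_mem (U := U.comap ⟨Quotient.mk s, continuous_quotient_mk'⟩)
      (V := V.comap ⟨Quotient.mk s, continuous_quotient_mk'⟩) (fun _ ha => h ha) _ hf
  locality := by
    intro U f hf
    refine F.locality _ fun a => ?_
    obtain ⟨V, h, haV, hV⟩ := hf ⟨_, a.2⟩
    exact ⟨V.comap ⟨Quotient.mk s, continuous_quotient_mk'⟩, fun _ hb => h hb, haV, hV⟩

end FunctionSheaf

/-- A Poisson algebra structure on a sheaf of algebras of functions: a `ℂ`-bilinear bracket on
the sections over every open set, commuting with restrictions, which is skew-symmetric and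
satisfies the Leibniz rule and the Jacobi identity. -/
structure PoissonStructure {X : Type*} [TopologicalSpace X] (F : FunctionSheaf X) where
  bracket : ∀ U : Opens X, F.sections U →ₗ[ℂ] F.sections U →ₗ[ℂ] F.sections U
  bracket_res : ∀ {U V : Opens X} (h : V ≤ U) (f g : F.sections U),
    F.res h (bracket U f g) = bracket V (F.res h f) (F.res h g)
  skew : ∀ (U : Opens X) (f g : F.sections U), bracket U f g = -bracket U g f
  leibniz : ∀ (U : Opens X) (f g h : F.sections U),
    bracket U f (g * h) = bracket U f g * h + g * bracket U f h
  jacobi : ∀ (U : Opens X) (f g h : F.sections U),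
    bracket U f (bracket U g h) + bracket U g (bracket U h f) + bracket U h (bracket U f g) = 0

/-! ### The affine space `M'(r,d)` -/

/-- Rows and columns are indexed by `Fin r`, so that the distinguished first index has value `0`.
`wt i` is `0` for this index and `1` for all others. -/
def wt {r : ℕ} (i : Fin r) : ℕ := if i.val = 0 then 0 else 1

/-- The number `d_{ij} + 1` of coefficients of the `(i,j)` entry: the first row has entries in
`S_d, S_{d+1}, …, S_{d+1}`, every other row has entries in `S_{d-1}, S_d, …, S_d`. -/
def entryLen (d : ℕ) {r : ℕ} (i j : Fin r) : ℕ :=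
  if i.val = 0 then (if j.val = 0 then d + 1 else d + 2)
  else (if j.val = 0 then d else d + 1)

/-- `M'(r,d)` as a linear subspace of the `r × r` matrices over `ℂ[x]`. -/
def mPrime (r d : ℕ) : Submodule ℂ (Matrix (Fin r) (Fin r) ℂ[X]) where
  carrier := {A | ∀ i j, A i j ∈ degreeLT ℂ (entryLen d i j)}
  add_mem' := fun hA hB i j => (degreeLT ℂ _).add_mem (hA i j) (hB i j)
  zero_mem' := fun _ _ => (degreeLT ℂ _).zero_mem
  smul_mem' := fun c _ hA i j => (degreeLT ℂ _).smul_mem c (hA i j)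

abbrev MPrime (r d : ℕ) : Type := mPrime r d

/-- The index set of the coordinates `A_{ij;k}`, `0 ≤ k ≤ d_{ij}`. -/
abbrev Coord (r d : ℕ) : Type := (p : Fin r × Fin r) × Fin (entryLen d p.1 p.2)

variable {r d : ℕ}

/-- The coordinate `A_{ij;k}` of `A`. -/
def coord (A : MPrime r d) (c : Coord r d) : ℂ := (A.1 c.1.1 c.1.2).coeff c.2

/-- The matrix with coordinate `A_{ij;k}` equal to one and all other coordinates zero. -/
def coordVec (c : Coord r d) : MPrime r d :=
  ⟨Matrix.single c.1.1 c.1.2 (monomial (c.2 : ℕ) (1 : ℂ)), by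
    intro i j
    by_cases h : c.1.1 = i ∧ c.1.2 = j
    · obtain ⟨rfl, rfl⟩ := h
      rw [Matrix.single_apply_same, mem_degreeLT]
      exact (degree_monomial_le _ _).trans_lt (by exact_mod_cast c.2.2)
    · rw [Matrix.single_apply_of_ne (h := h)]
      exact (degreeLT ℂ _).zero_mem⟩

/-- The value at `A` of a polynomial in the coordinates. -/
def evalAt (A : MPrime r d) (q : MvPolynomial (Coord r d) ℂ) : ℂ := MvPolynomial.eval (coord A) q

/-- The Zariski topology on `M'(r,d)`, with the sets `q ≠ 0` as basic open sets. -/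
instance zariski : TopologicalSpace (MPrime r d) :=
  generateFrom (Set.range fun q : MvPolynomial (Coord r d) ℂ => {A : MPrime r d | evalAt A q ≠ 0})

/-- The structure sheaf of `M'(r,d)`: regular functions, that is functions which are locally
quotients of polynomials in the coordinates. -/
def structureSheaf (r d : ℕ) : FunctionSheaf (MPrime r d) where
  sections U :=
    { carrier := {f | ∀ a : U, ∃ W : Opens (MPrime r d), a.1 ∈ W ∧
        ∃ p q : MvPolynomial (Coord r d) ℂ,
          ∀ b : U, b.1 ∈ W → evalAt b.1 q ≠ 0 ∧ f b = evalAt b.1 p / evalAt b.1 q}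
      mul_mem' := by
        intro f g hf hg a
        obtain ⟨W, haW, p, q, h⟩ := hf a
        obtain ⟨W', haW', p', q', h'⟩ := hg a
        refine ⟨W ⊓ W', ⟨haW, haW'⟩, p * p', q * q', fun b hb => ?_⟩
        obtain ⟨h1, h2⟩ := h b hb.1
        obtain ⟨h1', h2'⟩ := h' b hb.2
        unfold evalAt at *
        refine ⟨by simp [h1, h1'], ?_⟩
        simp only [Pi.mul_apply, h2, h2', map_mul]
        field_simp
      add_mem' := by
        intro f g hf hg a
        obtain ⟨W, haW, p, q, h⟩ := hf a
        obtain ⟨W', haW', p', q', h'⟩ := hg a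
        refine ⟨W ⊓ W', ⟨haW, haW'⟩, p * q' + q * p', q * q', fun b hb => ?_⟩
        obtain ⟨h1, h2⟩ := h b hb.1
        obtain ⟨h1', h2'⟩ := h' b hb.2
        unfold evalAt at *
        refine ⟨by simp [h1, h1'], ?_⟩
        simp only [Pi.add_apply, h2, h2', map_mul, map_add]
        field_simp
      algebraMap_mem' := by
        intro c a
        exact ⟨⊤, trivial, MvPolynomial.C c, 1, fun b _ => by simp [evalAt]⟩ }
  restrict_mem := by
    intro U V h f hf a
    obtain ⟨W, haW, p, q, H⟩ := hf ⟨a.1, h a.2⟩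
    exact ⟨W, haW, p, q, fun b hb => H ⟨b.1, h b.2⟩ hb⟩
  locality := by
    intro U f hf a
    obtain ⟨V, h, haV, hV⟩ := hf a
    obtain ⟨W, haW, p, q, H⟩ := hV ⟨a.1, haV⟩
    exact ⟨W ⊓ V, ⟨haW, haV⟩, p, q, fun b hb => H ⟨b.1, hb.2⟩ hb.1⟩

/-! ### The group `G_r` and its action -/

/-- Auxiliary degree filtration on matrices. -/
def filt (r m : ℕ) : Set (Matrix (Fin r) (Fin r) ℂ[X]) :=
  {A | ∀ i j, A i j ∈ degreeLT ℂ (m + wt j - wt i)}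

lemma mem_mPrime_iff (A : Matrix (Fin r) (Fin r) ℂ[X]) : A ∈ mPrime r d ↔ A ∈ filt r (d + 1) := by
  refine forall_congr' fun i => forall_congr' fun j => ?_
  have : entryLen d i j = d + 1 + wt j - wt i := by
    unfold entryLen wt
    split_ifs <;> omega
  rw [this]

lemma filt_mul {m n : ℕ} {A B : Matrix (Fin r) (Fin r) ℂ[X]} (hm : 1 ≤ m) (hn : 1 ≤ n)
    (hA : A ∈ filt r m) (hB : B ∈ filt r n) : A * B ∈ filt r (m + n - 1) := by
  intro i k
  rw [Matrix.mul_apply]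
  refine (degreeLT ℂ _).sum_mem fun j _ => ?_
  have h1 := hA i j
  have h2 := hB j k
  by_cases ha : A i j = 0
  · simp [ha]
  by_cases hb : B j k = 0
  · simp [hb]
  rw [mem_degreeLT, degree_eq_natDegree ha, Nat.cast_lt] at h1
  rw [mem_degreeLT, degree_eq_natDegree hb, Nat.cast_lt] at h2
  rw [mem_degreeLT, degree_eq_natDegree (mul_ne_zero ha hb), Nat.cast_lt, natDegree_mul ha hb]
  unfold wt at *
  split_ifs at * <;> omega

/-- The shape of the elements of `G_r`: first column `(1, 0, …, 0)`, linear polynomials in the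
rest of the first row, constants in the block `B`. -/
def HasShape (g : Matrix (Fin r) (Fin r) ℂ[X]) : Prop :=
  (∀ i j, i.val = 0 → j.val = 0 → g i j = 1) ∧
  (∀ i j, i.val ≠ 0 → j.val = 0 → g i j = 0) ∧
  (∀ i j, i.val = 0 → j.val ≠ 0 → g i j ∈ degreeLE ℂ 1) ∧
  (∀ i j, i.val ≠ 0 → j.val ≠ 0 → g i j ∈ degreeLE ℂ 0)

lemma hasShape_iff (g : Matrix (Fin r) (Fin r) ℂ[X]) :
    HasShape g ↔ (∀ i j, i.val = 0 → j.val = 0 → g i j = 1) ∧ g ∈ filt r 1 := by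
  have e0 : degreeLE ℂ 0 = degreeLT ℂ 1 := (degreeLT_succ_eq_degreeLE (n := 0)).symm
  have e1 : degreeLE ℂ 1 = degreeLT ℂ 2 := (degreeLT_succ_eq_degreeLE (n := 1)).symm
  have ez : ∀ p : ℂ[X], p ∈ degreeLT ℂ 0 ↔ p = 0 := fun p => by
    rw [mem_degreeLT]; simp [Nat.WithBot.lt_zero_iff]
  unfold HasShape
  rw [e0, e1]
  constructor
  · rintro ⟨h1, h2, h3, h4⟩
    refine ⟨h1, fun i j => ?_⟩
    unfold wt
    split_ifs with hj hi hi
    · rw [h1 i j hi hj, mem_degreeLT]; simp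
    · rw [h2 i j hi hj]; exact (degreeLT ℂ _).zero_mem
    · exact h3 i j hi hj
    · exact h4 i j hi hj
  · rintro ⟨h1, h⟩
    refine ⟨h1, ?_, ?_, ?_⟩ <;> intro i j hi hj <;> have := h i j <;> simp [wt, hi, hj] at this
    · exact (ez _).1 this
    · exact this
    · exact this

lemma HasShape.mul {g h : Matrix (Fin r) (Fin r) ℂ[X]} (hg : HasShape g) (hh : HasShape h) :
    HasShape (g * h) := by
  have h2 := hh.2.1
  rw [hasShape_iff] at *
  have h3 : g * h ∈ filt r (1 + 1 - 1) := filt_mul le_rfl le_rfl hg.2 hh.2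
  refine ⟨fun i j hi hj => ?_, by simpa using h3⟩
  rw [Matrix.mul_apply, Finset.sum_eq_single i]
  · rw [hg.1 i i hi hi, hh.1 i j hi hj, one_mul]
  · intro k _ hk
    rw [h2 k j (fun h0 => hk (Fin.ext (h0.trans hi.symm))) hj, mul_zero]
  · simp

lemma HasShape.one : HasShape (1 : Matrix (Fin r) (Fin r) ℂ[X]) := by
  rw [hasShape_iff]
  refine ⟨fun i j hi hj => by rw [Fin.ext (hi.trans hj.symm), Matrix.one_apply_eq], fun i j => ?_⟩
  by_cases h : i = j
  · subst h
    rw [Matrix.one_apply_eq, mem_degreeLT]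
    simp
  · rw [Matrix.one_apply_ne h]
    exact (degreeLT ℂ _).zero_mem

lemma HasShape.inv {g h : Matrix (Fin r) (Fin r) ℂ[X]} (hg : HasShape g) (hgh : g * h = 1)
    (hhg : h * g = 1) : HasShape h := by
  obtain ⟨g1, g2, g3, g4⟩ := hg
  have hcol : ∀ i j, j.val = 0 → h i j = (1 : Matrix (Fin r) (Fin r) ℂ[X]) i j := by
    intro i j hj
    rw [← hhg, Matrix.mul_apply, Finset.sum_eq_single j]
    · rw [g1 j j hj hj, mul_one]
    · intro k _ hk
      rw [g2 k j (fun h0 => hk (Fin.ext (h0.trans hj.symm))) hj, mul_zero]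
    · simp
  have h2 : ∀ i j, i.val ≠ 0 → j.val = 0 → h i j = 0 := by
    intro i j hi hj
    rw [hcol i j hj, Matrix.one_apply_ne (fun e => hi (by rw [e]; exact hj))]
  have h4 : ∀ i j, i.val ≠ 0 → h i j = C ((h i j).eval 0) := by
    set e : ℂ[X] →+* ℂ[X] := C.comp (evalRingHom 0) with he
    have hc : g.map e * h.map e = 1 := by
      rw [← Matrix.map_mul, hgh]
      exact Matrix.map_one e (map_zero e) (map_one e)
    have hrow : ∀ i k, i.val ≠ 0 → (g * (h - h.map e)) i k = 0 := by
      intro i k hi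
      have : (g * h) i k = (g.map e * h.map e) i k := by rw [hgh, hc]
      rw [Matrix.mul_sub, Matrix.sub_apply, this, sub_eq_zero, Matrix.mul_apply, Matrix.mul_apply]
      refine Finset.sum_congr rfl fun j _ => ?_
      congr 1
      by_cases hj : j.val = 0
      · simp [g2 i j hi hj]
      · have := g4 i j hi hj
        rw [mem_degreeLE] at this
        rw [Matrix.map_apply, eq_C_of_degree_le_zero this]
        simp [he]
    intro l k hl
    have : (h - h.map e) l k = 0 := by
      have h1 : h - h.map e = h * (g * (h - h.map e)) := by
        rw [← Matrix.mul_assoc, hhg, Matrix.one_mul]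
      rw [h1, Matrix.mul_apply]
      refine Finset.sum_eq_zero fun i _ => ?_
      by_cases hi : i.val = 0
      · rw [h2 l i hl hi, zero_mul]
      · rw [hrow i k hi, mul_zero]
    rw [Matrix.sub_apply, sub_eq_zero] at this
    exact this
  refine ⟨fun i j hi hj => ?_, h2, fun i j hi hj => ?_, fun i j hi hj => ?_⟩
  · rw [hcol i j hj, Fin.ext (hi.trans hj.symm), Matrix.one_apply_eq]
  · have hs : (g * h) i j = 0 := by
      rw [hgh, Matrix.one_apply_ne (fun e => hj (by rw [← e]; exact hi))]
    rw [Matrix.mul_apply, ← Finset.add_sum_erase _ _ (Finset.mem_univ i), g1 i i hi hi,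
      one_mul] at hs
    rw [eq_neg_of_add_eq_zero_left hs]
    refine (degreeLE ℂ 1).neg_mem ((degreeLE ℂ 1).sum_mem fun k hk => ?_)
    have hk0 : k.val ≠ 0 := fun h0 =>
      (Finset.ne_of_mem_erase hk) (Fin.ext (h0.trans hi.symm))
    have := g3 i k hi hk0
    rw [h4 k j hk0, mul_comm, ← smul_eq_C_mul]
    exact (degreeLE ℂ 1).smul_mem _ this
  · rw [mem_degreeLE, h4 i j hi]
    exact degree_C_le

/-- The group `G_r`. For a matrix of the given shape, invertibility over `ℂ[x]` means precisely
that the constant block `B` is invertible. -/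
def groupG (r : ℕ) : Subgroup (Matrix (Fin r) (Fin r) ℂ[X])ˣ where
  carrier := {g | HasShape g.1}
  mul_mem' := fun hg hh => HasShape.mul hg hh
  one_mem' := HasShape.one
  inv_mem' := fun {g} hg => HasShape.inv hg g.mul_inv g.inv_mul

/-- The action of `G_r` on `M'(r,d)` by conjugation, `A(x) ↦ g(x)⁻¹ A(x) g(x)`. -/
def conj (g : groupG r) (A : MPrime r d) : MPrime r d :=
  ⟨(g.1⁻¹).1 * A.1 * g.1.1, by
    rw [mem_mPrime_iff]
    have h1 := ((hasShape_iff _).1 (g⁻¹).2).2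
    have h2 := ((hasShape_iff _).1 g.2).2
    have h3 := filt_mul (by omega) (by omega) h1 ((mem_mPrime_iff _).1 A.2)
    have h4 := filt_mul (by omega) (by omega) h3 h2
    have e : 1 + (d + 1) - 1 + 1 - 1 = d + 1 := by omega
    rwa [e] at h4⟩

lemma conj_one (A : MPrime r d) : conj 1 A = A := Subtype.ext (by simp [conj])

lemma conj_mul (g h : groupG r) (A : MPrime r d) : conj (g * h) A = conj h (conj g A) :=
  Subtype.ext (by simp [conj, mul_assoc])

/-! Orbits of `G_r` are irreducible, which makes invariance of functions a local condition. -/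

lemma isTopologicalBasis_zariski : IsTopologicalBasis (Set.range fun
    q : MvPolynomial (Coord r d) ℂ => {A : MPrime r d | evalAt A q ≠ 0}) where
  exists_subset_inter := by
    rintro _ ⟨p, rfl⟩ _ ⟨q, rfl⟩ A ⟨hp, hq⟩
    refine ⟨_, ⟨p * q, rfl⟩, ?_, ?_⟩
    · change evalAt A (p * q) ≠ 0
      rw [evalAt, map_mul]
      exact mul_ne_zero hp hq
    · intro B hB
      change evalAt B (p * q) ≠ 0 at hB
      rw [evalAt, map_mul] at hB
      exact ⟨left_ne_zero_of_mul hB, right_ne_zero_of_mul hB⟩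
  sUnion_eq := Set.eq_univ_of_forall fun A => ⟨_, ⟨1, rfl⟩, by
    change evalAt A 1 ≠ 0
    simp [evalAt]⟩
  eq_generateFrom := rfl

lemma HasShape.det {g : Matrix (Fin r) (Fin r) ℂ[X]} (hg : HasShape g) :
    g.det = C (g.det.coeff 0) := by
  suffices h : ∃ c, g.det = C c by
    obtain ⟨c, hc⟩ := h
    rw [hc, coeff_C_zero]
  cases r with
  | zero => exact ⟨1, by simp⟩
  | succ n =>
    obtain ⟨g1, g2, g3, g4⟩ := hg
    have hsub : g.submatrix (Fin.succAbove 0) Fin.succ =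
        (Matrix.of fun i j : Fin n => (g i.succ j.succ).coeff 0).map (C : ℂ →+* ℂ[X]) := by
      ext1 i j
      have := g4 i.succ j.succ (by simp) (by simp)
      rw [mem_degreeLE] at this
      simpa using eq_C_of_degree_le_zero this
    rw [Matrix.det_succ_column_zero, Finset.sum_eq_single 0]
    · rw [hsub, g1 0 0 (by simp) (by simp)]
      refine ⟨(Matrix.of fun i j : Fin n => (g i.succ j.succ).coeff 0).det, ?_⟩
      rw [(C : ℂ →+* ℂ[X]).map_det]
      simp [RingHom.mapMatrix_apply]
    · intro i _ hi
      rw [g2 i 0 (fun h => hi (Fin.ext h)) (by simp)]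
      simp
    · simp

lemma exists_coeff_poly (P : ℂ[X][X]) (k : ℕ) :
    ∃ u : ℂ[X], ∀ t : ℂ, (P.eval (C t)).coeff k = u.eval t := by
  induction P using Polynomial.induction_on' with
  | add P Q hP hQ =>
    obtain ⟨u, hu⟩ := hP
    obtain ⟨v, hv⟩ := hQ
    exact ⟨u + v, fun t => by simp [hu, hv]⟩
  | monomial n a =>
    refine ⟨C (a.coeff k) * X ^ n, fun t => ?_⟩
    rw [eval_monomial, ← C_pow, coeff_mul_C]
    simp

lemma exists_clear {σ : Type*} (q : MvPolynomial σ ℂ) (u : σ → ℂ[X]) (δ : ℂ[X]) :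
    ∃ (N : ℕ) (F : ℂ[X]), ∀ t : ℂ, δ.eval t ≠ 0 → F.eval t =
      δ.eval t ^ N * MvPolynomial.eval (fun c => (u c).eval t / δ.eval t) q := by
  induction q using MvPolynomial.induction_on with
  | C a => exact ⟨0, C a, fun t _ => by simp⟩
  | add p q hp hq =>
    obtain ⟨N, F, hF⟩ := hp
    obtain ⟨M, G, hG⟩ := hq
    refine ⟨N + M, δ ^ M * F + δ ^ N * G, fun t ht => ?_⟩
    simp only [eval_add, eval_mul, eval_pow, hF t ht, hG t ht, map_add]
    ring
  | mul_X p i hp =>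
    obtain ⟨N, F, hF⟩ := hp
    refine ⟨N + 1, F * u i, fun t ht => ?_⟩
    simp only [eval_mul, hF t ht, map_mul, MvPolynomial.eval_X]
    rw [pow_succ]
    field_simp

lemma exists_conj_mem (A : MPrime r d) (g : groupG r) (V W : Opens (MPrime r d)) (hV : A ∈ V)
    (hW : conj g A ∈ W) : ∃ h : groupG r, conj h A ∈ V ∧ conj h A ∈ W := by
  obtain ⟨_, ⟨p, rfl⟩, hp, hpV⟩ :=
    isTopologicalBasis_zariski.exists_subset_of_mem_open hV V.2
  obtain ⟨_, ⟨q, rfl⟩, hq, hqW⟩ :=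
    isTopologicalBasis_zariski.exists_subset_of_mem_open hW W.2
  set L : Matrix (Fin r) (Fin r) ℂ[X][X] :=
    (1 - X : ℂ[X][X]) • 1 + (X : ℂ[X][X]) • g.1.1.map C with hL
  set S : ℂ → Matrix (Fin r) (Fin r) ℂ[X] := fun t => (1 - C t) • 1 + (C t) • g.1.1 with hS
  have hLS : ∀ t, (evalRingHom (C t)).mapMatrix L = S t := by
    intro t
    ext1 i j
    by_cases hij : i = j <;> simp [hL, hS, hij] <;> exact mul_comm _ _
  have hshape : ∀ t, HasShape (S t) := by
    intro t
    have h1 := (hasShape_iff _).1 (HasShape.one (r := r))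
    have h2 := (hasShape_iff _).1 g.2
    rw [hasShape_iff]
    have e : S t = (1 - t) • (1 : Matrix (Fin r) (Fin r) ℂ[X]) + t • g.1.1 := by
      ext1 i j
      simp [hS, smul_eq_C_mul]
    rw [e]
    refine ⟨fun i j hi hj => ?_, fun i j =>
      (degreeLT ℂ _).add_mem ((degreeLT ℂ _).smul_mem _ (h1.2 i j))
        ((degreeLT ℂ _).smul_mem _ (h2.2 i j))⟩
    rw [Matrix.add_apply, Matrix.smul_apply, Matrix.smul_apply, h1.1 i j hi hj, h2.1 i j hi hj,
      ← add_smul]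
    simp
  obtain ⟨δ, hδ⟩ := exists_coeff_poly L.det 0
  have hdet : ∀ t, (S t).det = C (δ.eval t) := by
    intro t
    rw [(hshape t).det, ← hδ t, ← hLS t, ← RingHom.map_det]
    rfl
  choose u hu using fun c : Coord r d =>
    exists_coeff_poly ((L.adjugate * A.1.map C * L) c.1.1 c.1.2) c.2
  have hmat : ∀ t, (evalRingHom (C t)).mapMatrix (L.adjugate * A.1.map C * L) =
      (S t).adjugate * A.1 * S t := by
    intro t
    rw [map_mul, map_mul, RingHom.map_adjugate, hLS]
    congr 2
    ext1 i j
    simp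
  have hS0 : S 0 = 1 := by simp [hS]
  have hS1 : S 1 = g.1.1 := by simp [hS]
  have hcoord : ∀ (h : groupG r) (t : ℂ), h.1.1 = S t → δ.eval t ≠ 0 ∧
      coord (conj h A) = fun c => (u c).eval t / δ.eval t := by
    intro h t ht
    have hd : h.1.1.det = C (δ.eval t) := by rw [ht, hdet]
    have hne : δ.eval t ≠ 0 := by
      intro h0
      have := (Matrix.isUnit_iff_isUnit_det _).1 h.1.isUnit
      rw [hd, h0, map_zero] at this
      exact not_isUnit_zero this
    refine ⟨hne, ?_⟩
    have hinv : (h.1⁻¹).1 = C ((δ.eval t)⁻¹) • (S t).adjugate := by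
      have : h.1.1 * (C ((δ.eval t)⁻¹) • (S t).adjugate) = 1 := by
        rw [ht, Matrix.mul_smul, Matrix.mul_adjugate, hdet, smul_smul, ← C_mul,
          inv_mul_cancel₀ hne, C_1, one_smul]
      exact (h.1.inv_eq_of_mul_eq_one_right this)
    funext c
    rw [← hu c t]
    have h1 := congrFun (congrFun (hmat t) c.1.1) c.1.2
    have h2 : ((L.adjugate * A.1.map C * L) c.1.1 c.1.2).eval (C t) =
      ((S t).adjugate * A.1 * S t) c.1.1 c.1.2 := h1
    have h3 : (conj h A).1 = C ((δ.eval t)⁻¹) • ((S t).adjugate * A.1 * S t) := by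
      change (h.1⁻¹).1 * A.1 * h.1.1 = _
      rw [hinv, ht, Matrix.smul_mul, Matrix.smul_mul]
    rw [coord, h2, h3, Matrix.smul_apply, smul_eq_mul, coeff_C_mul, div_eq_inv_mul]
  obtain ⟨N, F, hF⟩ := exists_clear p u δ
  obtain ⟨M, G, hG⟩ := exists_clear q u δ
  obtain ⟨hd0, hc0⟩ := hcoord 1 0 hS0.symm
  obtain ⟨hd1, hc1⟩ := hcoord g 1 hS1.symm
  have hF0 : F ≠ 0 := by
    rintro rfl
    have := hF 0 hd0
    rw [← hc0, conj_one, eval_zero] at this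
    exact (mul_ne_zero (pow_ne_zero _ hd0) hp) this.symm
  have hG0 : G ≠ 0 := by
    rintro rfl
    have := hG 1 hd1
    rw [← hc1, eval_zero] at this
    exact (mul_ne_zero (pow_ne_zero _ hd1) hq) this.symm
  have hδ0 : δ ≠ 0 := by
    rintro rfl
    exact hd0 eval_zero
  obtain ⟨t, ht⟩ : ∃ t, (F * G * δ).eval t ≠ 0 := by
    by_contra! hcon
    exact mul_ne_zero (mul_ne_zero hF0 hG0) hδ0 (Polynomial.funext (by simpa using hcon))
  rw [eval_mul, eval_mul] at ht
  have hδt := right_ne_zero_of_mul ht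
  have hunit : IsUnit (S t) := by
    rw [Matrix.isUnit_iff_isUnit_det, hdet]
    exact isUnit_C.2 (isUnit_iff_ne_zero.2 hδt)
  obtain ⟨v, hv⟩ := hunit
  let h : groupG r := ⟨v, show HasShape v.1 by rw [hv]; exact hshape t⟩
  obtain ⟨-, hc⟩ := hcoord h t hv
  refine ⟨h, hpV ?_, hqW ?_⟩
  · have h1 := hF t hδt
    rw [← hc] at h1
    change MvPolynomial.eval (coord (conj h A)) p ≠ 0
    intro h0
    rw [h0, mul_zero] at h1
    simp [h1] at ht
  · have h1 := hG t hδt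
    rw [← hc] at h1
    change MvPolynomial.eval (coord (conj h A)) q ≠ 0
    intro h0
    rw [h0, mul_zero] at h1
    simp [h1] at ht

/-- The sheaf of `G_r`-invariant regular functions on `M'(r,d)`. On an open set which is not
itself stable under `G_r`, invariance is required whenever a point and its translate both lie
in the set. -/
def invariantSheaf (r d : ℕ) : FunctionSheaf (MPrime r d) where
  sections U :=
    { carrier := {f | f ∈ (structureSheaf r d).sections U ∧
        ∀ (g : groupG r) (A B : U), B.1 = conj g A.1 → f B = f A}
      mul_mem' := fun hf hg => ⟨Subalgebra.mul_mem _ hf.1 hg.1, fun k A B h => by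
        simp [hf.2 k A B h, hg.2 k A B h]⟩
      add_mem' := fun hf hg => ⟨Subalgebra.add_mem _ hf.1 hg.1, fun k A B h => by
        simp [hf.2 k A B h, hg.2 k A B h]⟩
      algebraMap_mem' := fun c => ⟨Subalgebra.algebraMap_mem _ c, fun _ _ _ _ => rfl⟩ }
  restrict_mem := fun h f hf =>
    ⟨(structureSheaf r d).restrict_mem h f hf.1, fun g A B hAB =>
      hf.2 g ⟨A.1, h A.2⟩ ⟨B.1, h B.2⟩ hAB⟩
  locality := by
    intro U f hf
    refine ⟨(structureSheaf r d).locality f fun a => ?_, fun g A B hAB => ?_⟩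
    · obtain ⟨V, h, haV, hV⟩ := hf a
      exact ⟨V, h, haV, hV.1⟩
    · obtain ⟨V, hVU, hAV, -, hV⟩ := hf A
      obtain ⟨W, hWU, hBW, -, hW⟩ := hf B
      obtain ⟨k, hkV, hkW⟩ := exists_conj_mem A.1 g V W hAV (hAB ▸ hBW)
      have h1 := hV k ⟨A.1, hAV⟩ ⟨_, hkV⟩ rfl
      have h2 := hW (g⁻¹ * k) ⟨B.1, hBW⟩ ⟨_, hkW⟩ (by
        simp only [hAB]
        rw [← conj_mul, mul_inv_cancel_left])
      exact h2.symm.trans h1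

/-- The subset `M'(r,d)_{ir}`, where the spectral curve is irreducible. The spectral curve is the
closure of the affine curve `P(x,y) = 0` in a Hirzebruch surface, with `P = det (y - A(x))` monic
in `y`; it is an irreducible (integral) curve exactly if the affine curve is, that is if `P` is an
irreducible polynomial. `Matrix.charpoly` is `P` as an element of `ℂ[x][y]`. -/
def irr (r d : ℕ) : Set (MPrime r d) := {A | Irreducible A.1.charpoly}

lemma conj_mem_irr (g : groupG r) {A : MPrime r d} (hA : A ∈ irr r d) : conj g A ∈ irr r d := by
  have : (conj g A).1.charpoly = A.1.charpoly := by
    simp only [conj]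
    rw [Matrix.coe_units_inv]
    exact Matrix.charpoly_units_conj' g.1 A.1
  change Irreducible _
  rw [this]
  exact hA

/-- The orbit equivalence relation of `G_r` on `M'(r,d)_{ir}`. -/
def orbitSetoid (r d : ℕ) : Setoid (irr r d) where
  r A B := ∃ g : groupG r, B.1 = conj g A.1
  iseqv :=
    { refl := fun A => ⟨1, (conj_one _).symm⟩
      symm := by
        rintro A B ⟨g, h⟩
        exact ⟨g⁻¹, by rw [h, ← conj_mul, mul_inv_cancel, conj_one]⟩
      trans := by
        rintro A B C ⟨g, h⟩ ⟨g', h'⟩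
        exact ⟨g * g', by rw [h', h, conj_mul]⟩ }

/-- The phase space `M'(r,d)_{ir} / G_r`, with the quotient of the Zariski topology. -/
abbrev PhaseSpace (r d : ℕ) : Type := Quotient (orbitSetoid r d)

/-- The structure sheaf of the phase space: a function is regular if its pullback to
`M'(r,d)_{ir}` is regular. -/
def phaseSheaf (r d : ℕ) : FunctionSheaf (PhaseSpace r d) :=
  ((structureSheaf r d).induced (irr r d)).quotient (orbitSetoid r d)

/-! ### The truncated bracket -/

/-- The polynomial `(a(x) φ(y) - φ(x) a(y)) / (x - y)` in `ℂ[x][y]`. -/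
def divDiff (φ a : ℂ[X]) : ℂ[X][X] :=
  -((C a * φ.map C - C φ * a.map C) /ₘ (X - C X))

lemma divDiff_mul (φ a : ℂ[X]) : (C X - X) * divDiff φ a = C a * φ.map C - C φ * a.map C := by
  have h : IsRoot (C a * φ.map C - C φ * a.map C) (X : ℂ[X]) := by
    have : ∀ p : ℂ[X], (p.map C).eval X = p := fun p => by
      rw [eval_map]; exact eval₂_C_X
    simp [IsRoot, this, mul_comm]
  have h2 := mul_divByMonic_eq_iff_isRoot.2 h
  rw [divDiff]
  linear_combination h2

/-- The value at `A` of the bracket `{A_{ij;m}, A_{kl;n}}` of two coordinate functions, the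
coefficient of `x^m y^n` in
`δ_{il} (A_{kj}(x)φ(y) - φ(x)A_{kj}(y))/(x-y) - δ_{kj} (A_{il}(x)φ(y) - φ(x)A_{il}(y))/(x-y)`.
Only pairs with `m ≤ d_{ij}` and `n ≤ d_{kl}` occur, which is the truncation. -/
def coordBracket (φ : ℂ[X]) (a b : Coord r d) (A : MPrime r d) : ℂ :=
  (((if a.1.1 = b.1.2 then divDiff φ (A.1 b.1.1 a.1.2) else 0) -
    (if b.1.1 = a.1.2 then divDiff φ (A.1 a.1.1 b.1.2) else 0)).coeff b.2).coeff a.2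

/-- The partial derivative with respect to a coordinate. -/
def partialD (c : Coord r d) (F : MPrime r d → ℂ) (A : MPrime r d) : ℂ :=
  deriv (fun t : ℂ => F (A + t • coordVec c)) 0

/-- The truncated bracket of two functions, the biderivation with the prescribed values
on the coordinate functions. -/
def bvBracket (φ : ℂ[X]) (F H : MPrime r d → ℂ) (A : MPrime r d) : ℂ :=
  ∑ a : Coord r d, ∑ b : Coord r d, coordBracket φ a b A * partialD a F A * partialD b H A

open scoped Classical in
/-- Extension by zero of a function on a subset. For an open subset the values of `bvBracket`
on it do not depend on how the functions are extended. -/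
def extendZero {X : Type*} {U : Set X} (f : U → ℂ) (a : X) : ℂ := if h : a ∈ U then f ⟨a, h⟩ else 0

/-- The pullback to `M'(r,d)_{ir}` (extended by zero outside of the preimage of `V`) of a function
on an open set `V` of the phase space. -/
def pullback {V : Opens (PhaseSpace r d)} (f : V → ℂ) : MPrime r d → ℂ :=
  extendZero (U := irr r d) fun A => extendZero (U := (V : Set (PhaseSpace r d))) f
    (Quotient.mk (orbitSetoid r d) A)

end BV

end

/-!
# The truncated bracket on invariant functions

Under the residue pairing `⟨b, A⟩ = res tr (b A)` a linear functional on `M'(r,d)` is represented by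
a Laurent matrix `b`, and a differential `dF(A)` becomes such a matrix. In these terms the truncated
bracket is linear in `A` and is given by a Lie bracket on Laurent matrices (`poissonForm_eq_pair`):
`{F, H}(A) = ⟨A, [b, c]_φ⟩`, where `b`, `c` represent `dF(A)`, `dH(A)` and
`[b, c]_φ = [R b, c] + [b, R c] - φ [b, c]`, `R c = (φ c)₋`, the subscript denoting the polar part.
That `R` maps `[·, ·]_φ` to the commutator (`rOp_rBracket`) yields the Jacobi identity for
`[·, ·]_φ` (`rBracket_jacobi`). By `pair_rBracket`, `c` has the Hamiltonian vector field
`X_c(A) = [R c, A] - φ [c, A]₋`, which is a polynomial matrix, but not of the degrees allowed in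
`M'(r,d)`. So for general functionals the truncation interferes with the Jacobi identity.

Both `M'(r,d)` and the Lie algebra of `G_r` are described by one multiplicative filtration `lfilt`
of the Laurent matrices, in which entry `(i, j)` of an element of step `m` has degree at most
`m + wt j - wt i`: up to scalar matrices, the polynomial matrices in step `0` form the Lie algebra,
and those in step `d` form `M'(r,d)`. If `F` is invariant, then `c = dF(A)` annihilates all
`[A, ξ]` with `ξ` in the Lie algebra (`InvOn.annihilates`), which means exactly that `[c, A]₋` lies
in step `-2` (`Stationary.polarMat_lie_mem`). As `φ` has degree at most `d + 2`, it follows that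
`X_c(A)` does lie in `M'(r,d)`, so that nothing is truncated
(`Stationary.exists_toLMat_eq_hamField`). This has two consequences, both of them linear algebra at
a single point `A`. The first order part of the Jacobi identity is the Jacobi identity for
`[·, ·]_φ` (`poissonForm_hamVec_jacobi`); the terms with second derivatives cancel for every
skew-symmetric bracket. And conjugation by `g ∈ G_r` changes `X_c(A)` only by an infinitesimal gauge
transformation, which invariant functionals do not see, whence the bracket of invariant functions is
invariant (`poissonForm_conj`, `InvOn.bvBracket`).

On the phase space, sections are pulled back to functions on a subset of the locus of irreducible
spectral curves. Partial derivatives of such functions are meaningful since this locus meets every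
line in `M'(r,d)` in a set that is open for the classical topology
(`isOpen_setOf_line_mem_irr`): factorizations, with factors normalized to norm one, range over a
compact set, so reducibility is a closed condition. The calculus is therefore set up for functions
on subsets which are open along lines (`LineOpen`), and both sheaves are treated as presentations of
invariant regular functions on such subsets (`Presentation`).
-/

noncomputable section

namespace BV

section

open Polynomial TopologicalSpace LaurentPolynomial

attribute [local instance] LieRing.ofAssociativeRing

/-! ### Laurent polynomials: degree filtration and polar part -/

/-- Laurent polynomials of degree at most `m`. -/
def ordLE (m : ℤ) : Submodule ℂ ℂ[T;T⁻¹] where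
  carrier := {f | ∀ n, m < n → f.coeff n = 0}
  add_mem' hf hg n hn := by simp [hf n hn, hg n hn]
  zero_mem' n _ := by simp
  smul_mem' c f hf n hn := by simp [hf n hn]

/-- Laurent polynomials without terms of negative degree, that is, polynomials. -/
def regPart : Submodule ℂ ℂ[T;T⁻¹] where
  carrier := {f | ∀ n < 0, f.coeff n = 0}
  add_mem' hf hg n hn := by simp [hf n hn, hg n hn]
  zero_mem' n _ := by simp
  smul_mem' c f hf n hn := by simp [hf n hn]

lemma exists_of_coeff_mul_ne_zero {f g : ℂ[T;T⁻¹]} {n : ℤ} (h : (f * g).coeff n ≠ 0) :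
    ∃ i j, f.coeff i ≠ 0 ∧ g.coeff j ≠ 0 ∧ i + j = n := by
  have h1 := AddMonoidAlgebra.support_coeff_mul_subset f g (Finsupp.mem_support_iff.2 h)
  obtain ⟨i, hi, j, hj, rfl⟩ := Finset.mem_add.1 h1
  exact ⟨i, j, Finsupp.mem_support_iff.1 hi, Finsupp.mem_support_iff.1 hj, rfl⟩

lemma ordLE_mul {m n k : ℤ} (hk : m + n ≤ k) {f g : ℂ[T;T⁻¹]} (hf : f ∈ ordLE m)
    (hg : g ∈ ordLE n) : f * g ∈ ordLE k := by
  intro l hl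
  by_contra h
  obtain ⟨i, j, hi, hj, rfl⟩ := exists_of_coeff_mul_ne_zero h
  have h1 : ¬ m < i := fun h1 => hi (hf i h1)
  have h2 : ¬ n < j := fun h2 => hj (hg j h2)
  omega

lemma ordLE_mono {m n : ℤ} (h : m ≤ n) : ordLE m ≤ ordLE n := fun _ hf k hk => hf k (h.trans_lt hk)

lemma regPart_mul {f g : ℂ[T;T⁻¹]} (hf : f ∈ regPart) (hg : g ∈ regPart) : f * g ∈ regPart := by
  intro l hl
  by_contra h
  obtain ⟨i, j, hi, hj, rfl⟩ := exists_of_coeff_mul_ne_zero h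
  have h1 : ¬ i < 0 := fun h1 => hi (hf i h1)
  have h2 : ¬ j < 0 := fun h2 => hj (hg j h2)
  omega

/-- The polar part of a Laurent polynomial: the sum of its terms of negative degree. -/
def polar : ℂ[T;T⁻¹] →ₗ[ℂ] ℂ[T;T⁻¹] where
  toFun f := .ofCoeff (f.coeff.filter (· < 0))
  map_add' f g := by ext n; simp [Finsupp.filter_apply]
  map_smul' c f := by ext n; simp [Finsupp.filter_apply]

lemma coeff_polar (f : ℂ[T;T⁻¹]) (n : ℤ) :
    (polar f).coeff n = if n < 0 then f.coeff n else 0 := by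
  simp [polar, Finsupp.filter_apply]

lemma polar_eq_zero {f : ℂ[T;T⁻¹]} (hf : f ∈ regPart) : polar f = 0 := by
  ext n
  rw [coeff_polar]
  split_ifs with h
  · exact hf n h
  · rfl

lemma polar_eq_self {f : ℂ[T;T⁻¹]} (hf : f ∈ ordLE (-1)) : polar f = f := by
  ext n
  rw [coeff_polar]
  split_ifs with h
  · rfl
  · exact (hf n (by omega)).symm

lemma polar_mem (f : ℂ[T;T⁻¹]) : polar f ∈ ordLE (-1) := by
  intro n hn
  rw [coeff_polar, if_neg (by omega)]

lemma polar_mem_of_mem {m : ℤ} {f : ℂ[T;T⁻¹]} (hf : f ∈ ordLE m) : polar f ∈ ordLE m := by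
  intro n hn
  rw [coeff_polar, hf n hn, ite_self]

lemma sub_polar_mem (f : ℂ[T;T⁻¹]) : f - polar f ∈ regPart := by
  intro n hn
  simp [coeff_polar, hn]

lemma toLaurent_mem_regPart (p : ℂ[X]) : toLaurent p ∈ regPart := by
  intro n hn
  rw [coeff_toLaurent, Finsupp.mapDomain_of_notMem_range]
  rintro ⟨k, rfl⟩
  simp at hn
  omega

lemma coeff_toLaurent_natCast (p : ℂ[X]) (n : ℕ) : (toLaurent p).coeff n = p.coeff n := by
  rw [coeff_toLaurent]
  exact Finsupp.mapDomain_apply Nat.cast_injective _ _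

lemma toLaurent_mem_ordLE {p : ℂ[X]} {m : ℕ} {k : ℤ} (hk : (m : ℤ) ≤ k + 1)
    (hp : p ∈ degreeLT ℂ m) : toLaurent p ∈ ordLE k := by
  intro n hn
  obtain hn0 | hn0 := lt_or_ge n 0
  · exact toLaurent_mem_regPart p n hn0
  · lift n to ℕ using hn0
    rw [coeff_toLaurent_natCast]
    rw [mem_degreeLT] at hp
    exact coeff_eq_zero_of_degree_lt (hp.trans_le (by exact_mod_cast (by omega : m ≤ n)))

lemma exists_toLaurent {f : ℂ[T;T⁻¹]} {m : ℕ} {k : ℤ} (hk : k + 1 ≤ m) (hf : f ∈ regPart)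
    (hf' : f ∈ ordLE k) : ∃ p ∈ degreeLT ℂ m, toLaurent p = f := by
  refine ⟨∑ i ∈ Finset.range m, monomial i (f.coeff i), ?_, ?_⟩
  · refine Submodule.sum_mem _ fun i hi => ?_
    rw [mem_degreeLT]
    exact (degree_monomial_le _ _).trans_lt (by exact_mod_cast Finset.mem_range.1 hi)
  · ext n
    obtain hn0 | hn0 := lt_or_ge n 0
    · rw [hf n hn0]; exact toLaurent_mem_regPart _ n hn0
    · lift n to ℕ using hn0
      rw [coeff_toLaurent_natCast]
      simp only [finsetSum_coeff, coeff_monomial, Finset.sum_ite_eq', Finset.mem_range]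
      split_ifs with h
      · rfl
      · exact (hf' n (by omega)).symm

lemma coeff_mul_T (f : ℂ[T;T⁻¹]) (m n : ℤ) : (f * T m).coeff n = f.coeff (n - m) := by
  rw [T, ← mul_one (f.coeff (n - m))]
  exact AddMonoidAlgebra.coeff_mul_single_eq_coeff_mul _ (by intro a _; omega)

/-! ### Laurent matrices: the residue pairing and the `R`-bracket -/

variable {r d : ℕ}

/-- Square matrices with Laurent polynomial entries. -/
abbrev LMat (r : ℕ) : Type := Matrix (Fin r) (Fin r) ℂ[T;T⁻¹]

/-- Laurent matrices with polynomial entries. -/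
def regMat (r : ℕ) : Submodule ℂ (LMat r) where
  carrier := {A | ∀ i j, A i j ∈ regPart}
  add_mem' hA hB i j := regPart.add_mem (hA i j) (hB i j)
  zero_mem' _ _ := regPart.zero_mem
  smul_mem' c _ hA i j := regPart.smul_mem c (hA i j)

/-- The filtration of Laurent matrices: entry `(i, j)` of an element of the `m`-th step has degree
at most `m + wt j - wt i`. -/
def lfilt (r : ℕ) (m : ℤ) : Submodule ℂ (LMat r) where
  carrier := {A | ∀ i j, A i j ∈ ordLE (m + wt j - wt i)}
  add_mem' hA hB i j := (ordLE _).add_mem (hA i j) (hB i j)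
  zero_mem' _ _ := (ordLE _).zero_mem
  smul_mem' c _ hA i j := (ordLE _).smul_mem c (hA i j)

/-- The entrywise polar part. -/
def polarMat : LMat r →ₗ[ℂ] LMat r := polar.mapMatrix

lemma polarMat_apply (A : LMat r) (i j) : polarMat A i j = polar (A i j) := rfl

lemma regMat_mul {A B : LMat r} (hA : A ∈ regMat r) (hB : B ∈ regMat r) : A * B ∈ regMat r := by
  intro i j
  rw [Matrix.mul_apply]
  exact regPart.sum_mem fun k _ => regPart_mul (hA i k) (hB k j)

lemma regMat_lie {A B : LMat r} (hA : A ∈ regMat r) (hB : B ∈ regMat r) : ⁅A, B⁆ ∈ regMat r :=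
  (regMat r).sub_mem (regMat_mul hA hB) (regMat_mul hB hA)

lemma regMat_smul {φ : ℂ[T;T⁻¹]} {A : LMat r} (hφ : φ ∈ regPart) (hA : A ∈ regMat r) :
    φ • A ∈ regMat r := fun i j => regPart_mul hφ (hA i j)

lemma lfilt_mul {m n : ℤ} {A B : LMat r} (hA : A ∈ lfilt r m) (hB : B ∈ lfilt r n) :
    A * B ∈ lfilt r (m + n) := by
  intro i j
  rw [Matrix.mul_apply]
  exact (ordLE _).sum_mem fun k _ => ordLE_mul (by omega) (hA i k) (hB k j)

lemma lfilt_lie {m n : ℤ} {A B : LMat r} (hA : A ∈ lfilt r m) (hB : B ∈ lfilt r n) :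
    ⁅A, B⁆ ∈ lfilt r (m + n) :=
  (lfilt r _).sub_mem (lfilt_mul hA hB) (add_comm n m ▸ lfilt_mul hB hA)

lemma lfilt_smul {m n : ℤ} {φ : ℂ[T;T⁻¹]} {A : LMat r} (hφ : φ ∈ ordLE m) (hA : A ∈ lfilt r n) :
    φ • A ∈ lfilt r (m + n) := fun i j => ordLE_mul (by omega) hφ (hA i j)

lemma wt_le_one (i : Fin r) : wt i ≤ 1 := by
  unfold wt; split_ifs <;> simp

/-- Polar matrices lie in the zeroth step of the filtration, because the weights are at most one. -/
lemma polarMat_mem_lfilt_zero (A : LMat r) : polarMat A ∈ lfilt r 0 := fun i j =>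
  ordLE_mono (by have := wt_le_one i; omega) (polar_mem _)

lemma polarMat_mem_lfilt {m : ℤ} {A : LMat r} (hA : A ∈ lfilt r m) : polarMat A ∈ lfilt r m :=
  fun i j => polar_mem_of_mem (hA i j)

lemma polarMat_eq_zero {A : LMat r} (hA : A ∈ regMat r) : polarMat A = 0 := by
  ext1 i j
  exact polar_eq_zero (hA i j)

lemma polarMat_eq_self {A : LMat r} (hA : ∀ i j, A i j ∈ ordLE (-1)) : polarMat A = A := by
  ext1 i j
  exact polar_eq_self (hA i j)

/-- Step `-2` of the filtration consists of polar matrices, because the weights are at most one. -/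
lemma polarMat_eq_self_of_lfilt {A : LMat r} (hA : A ∈ lfilt r (-2)) : polarMat A = A :=
  polarMat_eq_self fun i j => ordLE_mono (by have := wt_le_one j; omega) (hA i j)

lemma sub_polarMat_mem (A : LMat r) : A - polarMat A ∈ regMat r := fun i j => sub_polar_mem (A i j)

lemma polarMat_lie_polarMat (A B : LMat r) :
    polarMat ⁅polarMat A, polarMat B⁆ = ⁅polarMat A, polarMat B⁆ := by
  refine polarMat_eq_self fun i j => ?_
  have h : ∀ A B : LMat r, (polarMat A * polarMat B) i j ∈ ordLE (-1) := fun A B => by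
    rw [Matrix.mul_apply]
    exact (ordLE _).sum_mem fun k _ => ordLE_mul (by omega) (polar_mem _) (polar_mem _)
  exact (ordLE _).sub_mem (h A B) (h B A)

/-- The residue pairing: the coefficient of `x⁻¹` in the trace of the product. -/
def pair : LMat r →ₗ[ℂ] LMat r →ₗ[ℂ] ℂ :=
  LinearMap.mk₂ ℂ (fun A B => ((A * B).trace).coeff (-1))
    (fun A B C => by simp [add_mul]) (fun c A B => by simp)
    (fun A B C => by simp [mul_add]) (fun c A B => by simp)

lemma pair_apply (A B : LMat r) : pair A B = ((A * B).trace).coeff (-1) := rfl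

lemma pair_comm (A B : LMat r) : pair A B = pair B A := by
  rw [pair_apply, Matrix.trace_mul_comm, pair_apply]

lemma pair_lie (A B C : LMat r) : pair A ⁅B, C⁆ = pair ⁅A, B⁆ C := by
  simp only [pair_apply, Ring.lie_def, mul_sub, sub_mul, Matrix.trace_sub, ← mul_assoc]
  rw [Matrix.trace_mul_cycle A C B]

lemma pair_smul_left (φ : ℂ[T;T⁻¹]) (A B : LMat r) : pair (φ • A) B = pair A (φ • B) := by
  simp [pair_apply]

lemma pair_conj {g h : LMat r} (hgh : g * h = 1) (A B : LMat r) :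
    pair (h * A * g) (h * B * g) = pair A B := by
  rw [pair_apply, pair_apply]
  have : h * A * g * (h * B * g) = h * (A * B) * g := by
    calc h * A * g * (h * B * g) = h * A * (g * h) * (B * g) := by simp only [mul_assoc]
      _ = _ := by rw [hgh, mul_one]; simp only [mul_assoc]
  rw [this, Matrix.trace_mul_cycle, hgh, one_mul]

lemma coeff_trace (A : LMat r) (n : ℤ) : (A.trace).coeff n = ∑ i, (A i i).coeff n := by
  simp [Matrix.trace]

lemma pair_eq_zero_of_reg {A B : LMat r} (hA : A ∈ regMat r) (hB : B ∈ regMat r) :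
    pair A B = 0 := by
  rw [pair_apply, coeff_trace]
  exact Finset.sum_eq_zero fun i _ => regMat_mul hA hB i i (-1) (by omega)

/-- The operator `c ↦ (φ c)₋`. -/
def rOp (φ : ℂ[T;T⁻¹]) (c : LMat r) : LMat r := polarMat (φ • c)

/-- The second Lie bracket `[Rb, c] + [b, Rc] - φ [b, c]` on Laurent matrices, `R c = (φ c)₋`. -/
def rBracket (φ : ℂ[T;T⁻¹]) (b c : LMat r) : LMat r :=
  ⁅rOp φ b, c⁆ + ⁅b, rOp φ c⁆ - φ • ⁅b, c⁆

/-- The Hamiltonian vector field at `A` of a linear functional represented by `c`. -/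
def hamField (φ : ℂ[T;T⁻¹]) (A c : LMat r) : LMat r := ⁅rOp φ c, A⁆ - φ • polarMat ⁅c, A⁆

lemma rOp_add (φ : ℂ[T;T⁻¹]) (b c : LMat r) : rOp φ (b + c) = rOp φ b + rOp φ c := by
  simp [rOp]

lemma rOp_smul (φ : ℂ[T;T⁻¹]) (t : ℂ) (c : LMat r) : rOp φ (t • c) = t • rOp φ c := by
  rw [rOp, smul_comm, map_smul, rOp]

lemma rBracket_skew (φ : ℂ[T;T⁻¹]) (b c : LMat r) : rBracket φ b c = -rBracket φ c b := by
  simp only [rBracket]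
  rw [← lie_skew (rOp φ b) c, ← lie_skew b (rOp φ c), ← lie_skew b c, smul_neg]
  abel

/-- The Lie bracket `rBracket φ` as a bilinear map. -/
def rBracketₗ (φ : ℂ[T;T⁻¹]) : LMat r →ₗ[ℂ] LMat r →ₗ[ℂ] LMat r :=
  LinearMap.mk₂ ℂ (rBracket φ)
    (fun a b c => by simp only [rBracket, rOp_add, add_lie, smul_add]; abel)
    (fun t b c => by simp only [rBracket, rOp_smul, smul_lie, smul_add, smul_sub, smul_comm t φ])
    (fun a b c => by simp only [rBracket, rOp_add, lie_add, smul_add]; abel)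
    (fun t b c => by simp only [rBracket, rOp_smul, lie_smul, smul_add, smul_sub, smul_comm t φ])

/-- The operator `R` is a homomorphism from `rBracket φ` to the commutator. -/
lemma rOp_rBracket (φ : ℂ[T;T⁻¹]) (b c : LMat r) :
    rOp φ (rBracket φ b c) = ⁅rOp φ b, rOp φ c⁆ := by
  set u := φ • b with hu
  set v := φ • c with hv
  have h : φ • rBracket φ b c = ⁅polarMat u, polarMat v⁆ - ⁅u - polarMat u, v - polarMat v⁆ := by
    have e1 : φ • ⁅rOp φ b, c⁆ = ⁅polarMat u, v⁆ := by rw [hv, lie_smul]; rfl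
    have e2 : φ • ⁅b, rOp φ c⁆ = ⁅u, polarMat v⁆ := by rw [hu, smul_lie]; rfl
    have e3 : φ • φ • ⁅b, c⁆ = ⁅u, v⁆ := by rw [hu, hv, smul_lie, lie_smul]
    rw [rBracket, smul_sub, smul_add, e1, e2, e3]
    simp only [lie_sub, sub_lie]
    abel
  rw [rOp, h, map_sub, polarMat_lie_polarMat,
    polarMat_eq_zero (regMat_lie (sub_polarMat_mem u) (sub_polarMat_mem v)), sub_zero]
  rfl

lemma rBracket_jacobi (φ : ℂ[T;T⁻¹]) (a b c : LMat r) :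
    rBracket φ a (rBracket φ b c) + rBracket φ b (rBracket φ c a) +
      rBracket φ c (rBracket φ a b) = 0 := by
  have h : ∀ a b c : LMat r, rBracket φ a (rBracket φ b c) =
      ⁅rOp φ a, ⁅rOp φ b, c⁆⁆ + ⁅rOp φ a, ⁅b, rOp φ c⁆⁆ - φ • ⁅rOp φ a, ⁅b, c⁆⁆ +
        ⁅a, ⁅rOp φ b, rOp φ c⁆⁆ - (φ • ⁅a, ⁅rOp φ b, c⁆⁆ + φ • ⁅a, ⁅b, rOp φ c⁆⁆
          - φ • φ • ⁅a, ⁅b, c⁆⁆) := by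
    intro a b c
    rw [rBracket, rOp_rBracket]
    simp only [rBracket, lie_add, lie_sub, lie_smul, smul_add, smul_sub]
  have j := fun x y z : LMat r => lie_jacobi x y z
  rw [h a b c, h b c a, h c a b]
  linear_combination (norm := module) j (rOp φ a) (rOp φ b) c + j (rOp φ a) b (rOp φ c)
    + j a (rOp φ b) (rOp φ c) - φ • j (rOp φ a) b c - φ • j a (rOp φ b) c - φ • j a b (rOp φ c)
    + φ • φ • j a b c

/-- Moving `b` out of the second Lie bracket; this uses only that the polynomial matrices and the
polar matrices are isotropic for the residue pairing. -/
lemma pair_rBracket (φ : ℂ[T;T⁻¹]) (A b c : LMat r) :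
    pair A (rBracket φ b c) = pair b (hamField φ A c) := by
  have h1 : pair b (φ • polarMat ⁅c, A⁆) = pair (φ • b - rOp φ b) ⁅c, A⁆ := by
    have e1 : pair (polarMat (φ • b)) (polarMat ⁅c, A⁆) = 0 := by
      rw [pair_apply, coeff_trace]
      refine Finset.sum_eq_zero fun i _ => ?_
      rw [Matrix.mul_apply]
      have : ∑ j, polarMat (φ • b) i j * polarMat ⁅c, A⁆ j i ∈ ordLE (-2) :=
        (ordLE _).sum_mem fun k _ => ordLE_mul (by omega) (polar_mem _) (polar_mem _)
      exact this (-1) (by omega)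
    have e2 := pair_eq_zero_of_reg (sub_polarMat_mem (φ • b)) (sub_polarMat_mem ⁅c, A⁆)
    rw [← pair_smul_left]
    rw [map_sub] at e2
    have e3 : pair (φ • b) (polarMat ⁅c, A⁆) =
        pair (φ • b - polarMat (φ • b)) (polarMat ⁅c, A⁆) := by
      rw [map_sub, LinearMap.sub_apply, e1, sub_zero]
    rw [e3]
    exact (sub_eq_zero.1 e2).symm
  rw [hamField, map_sub, h1, pair_lie, pair_lie, pair_comm A, ← LinearMap.sub_apply, ← map_sub]
  congr 2
  rw [rBracket, sub_lie, smul_lie]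
  abel

/-- Hamiltonian vector fields are polynomial: the polar parts of the two terms cancel. -/
lemma hamField_mem_reg {φ : ℂ[T;T⁻¹]} {A : LMat r} (hφ : φ ∈ regPart) (hA : A ∈ regMat r)
    (c : LMat r) : hamField φ A c ∈ regMat r := by
  have h1 := regMat_lie (sub_polarMat_mem (φ • c)) hA
  have h2 := regMat_smul hφ (sub_polarMat_mem ⁅c, A⁆)
  have h3 := (regMat r).sub_mem h2 h1
  convert h3 using 1
  rw [hamField, rOp, smul_sub, sub_lie, smul_lie]
  abel

/-! ### Stationary functionals and gauge equivariance -/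

/-- `c` annihilates all infinitesimal gauge transformations `[A, ξ]` of `A`, where `ξ` runs over
the polynomial matrices in the zeroth step of the filtration. -/
def Stationary (A c : LMat r) : Prop :=
  ∀ ξ ∈ regMat r, ξ ∈ lfilt r 0 → pair c ⁅A, ξ⁆ = 0

lemma pair_single (A : LMat r) (i j : Fin r) (k : ℤ) :
    pair A (Matrix.single j i (T k)) = (A i j).coeff (-1 - k) := by
  have h : (A * Matrix.single j i (T k)).trace = A i j * T k := by
    rw [Matrix.trace_mul_comm, Matrix.trace_single_mul, smul_eq_mul, mul_comm]
  rw [pair_apply, h, coeff_mul_T]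

lemma T_mem_ordLE {k m : ℤ} (h : k ≤ m) : (T k : ℂ[T;T⁻¹]) ∈ ordLE m := by
  intro n hn
  rw [T_apply, if_neg (by omega)]

lemma T_mem_regPart {k : ℤ} (h : 0 ≤ k) : (T k : ℂ[T;T⁻¹]) ∈ regPart := by
  intro n hn
  rw [T_apply, if_neg (by omega)]

/-- The polar part of `[c, A]` lies in the step `-2` of the filtration: the infinitesimal gauge
transformations `x ^ k E_{ji}` detect exactly the coefficients which have to vanish. -/
lemma Stationary.polarMat_lie_mem {A c : LMat r} (h : Stationary A c) :
    polarMat ⁅c, A⁆ ∈ lfilt r (-2) := by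
  intro i j n hn
  rw [polarMat_apply, coeff_polar]
  split_ifs with h0
  · have h1 := h (Matrix.single j i (T (-1 - n))) ?_ ?_
    · rw [pair_lie, pair_single] at h1
      simpa using h1
    · intro k l
      rw [Matrix.single_apply]
      split_ifs
      · exact T_mem_regPart (by omega)
      · exact regPart.zero_mem
    · intro k l
      rw [Matrix.single_apply]
      split_ifs with hkl
      · rw [← hkl.1, ← hkl.2]
        exact T_mem_ordLE (by omega)
      · exact (ordLE _).zero_mem
  · rfl

lemma Stationary.hamField_mem_lfilt {φ : ℂ[T;T⁻¹]} {m : ℤ} {A c : LMat r} (hφ : φ ∈ ordLE (m + 2))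
    (hA : A ∈ lfilt r m) (h : Stationary A c) : hamField φ A c ∈ lfilt r m := by
  refine (lfilt r m).sub_mem ?_ ?_
  · exact zero_add m ▸ lfilt_lie (polarMat_mem_lfilt_zero (φ • c)) hA
  · simpa using lfilt_smul hφ h.polarMat_lie_mem

lemma lie_conj {g h : LMat r} (hgh : g * h = 1) (A B : LMat r) :
    ⁅h * A * g, h * B * g⁆ = h * ⁅A, B⁆ * g := by
  have : ∀ A B : LMat r, h * A * g * (h * B * g) = h * (A * B) * g := fun A B => by
    calc h * A * g * (h * B * g) = h * A * (g * h) * (B * g) := by simp only [mul_assoc]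
      _ = _ := by rw [hgh, mul_one]; simp only [mul_assoc]
  rw [Ring.lie_def, Ring.lie_def, this, this, mul_sub, sub_mul]

lemma conj_mem_lfilt {m : ℤ} {g h A : LMat r} (hg : g ∈ lfilt r 0) (hh : h ∈ lfilt r 0)
    (hA : A ∈ lfilt r m) : h * A * g ∈ lfilt r m := by
  simpa using lfilt_mul (lfilt_mul hh hA) hg

/-- `h` is inverse to `g`, and both are polynomial matrices in the zeroth step of the filtration. -/
structure IsGauge (g h : LMat r) : Prop where
  reg : g ∈ regMat r
  filt : g ∈ lfilt r 0
  reg' : h ∈ regMat r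
  filt' : h ∈ lfilt r 0
  mul_eq : g * h = 1
  mul_eq' : h * g = 1

lemma Stationary.conj {g h A c : LMat r} (hg : IsGauge g h) (hc : Stationary A c) :
    Stationary (h * A * g) (h * c * g) := by
  intro ξ hξ hξ'
  have e : ξ = h * (g * ξ * h) * g := by
    calc ξ = (h * g) * ξ * (h * g) := by rw [hg.mul_eq', one_mul, mul_one]
      _ = _ := by simp only [mul_assoc]
  rw [e, lie_conj hg.mul_eq, pair_conj hg.mul_eq]
  exact hc _ (regMat_mul (regMat_mul hg.reg hξ) hg.reg') (conj_mem_lfilt hg.filt' hg.filt hξ')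

/-- Hamiltonian vector fields of stationary functionals are gauge equivariant up to an
infinitesimal gauge transformation. -/
lemma Stationary.exists_hamField_conj {g h A c : LMat r} (hg : IsGauge g h)
    (hc : Stationary A c) (φ : ℂ[T;T⁻¹]) :
    ∃ ξ ∈ regMat r, ξ ∈ lfilt r 0 ∧
      hamField φ (h * A * g) (h * c * g) = h * hamField φ A c * g + ⁅h * A * g, ξ⁆ := by
  have hconj : ∀ {B : LMat r}, B ∈ regMat r → h * B * g ∈ regMat r := fun hB =>
    regMat_mul (regMat_mul hg.reg' hB) hg.reg
  have hpol : ∀ B : LMat r, polarMat (h * B * g) = polarMat (h * polarMat B * g) := by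
    intro B
    have := polarMat_eq_zero (hconj (sub_polarMat_mem B))
    rwa [mul_sub, sub_mul, map_sub, sub_eq_zero] at this
  set Y := h * polarMat (φ • c) * g with hY
  refine ⟨Y - polarMat Y, sub_polarMat_mem _, ?_, ?_⟩
  · have hY0 : Y ∈ lfilt r 0 := conj_mem_lfilt hg.filt hg.filt' (polarMat_mem_lfilt_zero _)
    exact (lfilt r 0).sub_mem hY0 (polarMat_mem_lfilt hY0)
  · have h1 : rOp φ (h * c * g) = polarMat Y := by
      rw [hY, ← hpol, rOp, mul_smul_comm, smul_mul_assoc]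
    have h2 : polarMat ⁅h * c * g, h * A * g⁆ = h * polarMat ⁅c, A⁆ * g := by
      rw [lie_conj hg.mul_eq, hpol]
      exact polarMat_eq_self_of_lfilt (conj_mem_lfilt hg.filt hg.filt' hc.polarMat_lie_mem)
    have h3 : ⁅Y, h * A * g⁆ = h * ⁅rOp φ c, A⁆ * g := by rw [hY, lie_conj hg.mul_eq]; rfl
    rw [hamField, hamField, h1, h2, mul_sub, sub_mul, ← h3, ← lie_skew (h * A * g), sub_lie,
      mul_smul_comm, smul_mul_assoc]
    abel

lemma Stationary.pair_rBracket_conj {g h A b c : LMat r} (hg : IsGauge g h)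
    (hb : Stationary A b) (hc : Stationary A c) (φ : ℂ[T;T⁻¹]) : pair (h * A * g) (rBracket φ (h * b * g) (h * c * g)) =
      pair A (rBracket φ b c) := by
  obtain ⟨ξ, hξ, hξ', e⟩ := hc.exists_hamField_conj hg φ
  rw [pair_rBracket, pair_rBracket, e, map_add, pair_conj hg.mul_eq,
    hb.conj hg ξ hξ hξ', add_zero]

/-! ### Polynomial matrices inside Laurent matrices -/

/-- The inclusion of polynomial matrices into Laurent matrices. -/
def toLMat (r : ℕ) : Matrix (Fin r) (Fin r) ℂ[X] →ₐ[ℂ] LMat r := (toLaurentAlg (R := ℂ)).mapMatrix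

lemma toLMat_apply (A : Matrix (Fin r) (Fin r) ℂ[X]) (i j) : toLMat r A i j = toLaurent (A i j) :=
  rfl

lemma toLMat_mem_reg (A : Matrix (Fin r) (Fin r) ℂ[X]) : toLMat r A ∈ regMat r := fun _ _ =>
  toLaurent_mem_regPart _

lemma toLMat_mem_lfilt {m : ℕ} {A : Matrix (Fin r) (Fin r) ℂ[X]} (hA : A ∈ filt r (m + 1)) :
    toLMat r A ∈ lfilt r m := fun i j =>
  toLaurent_mem_ordLE (by have := wt_le_one i; omega) (hA i j)

lemma toLMat_injective : Function.Injective (toLMat r) := fun A B h => by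
  ext1 i j
  exact toLaurent_injective (congrFun (congrFun h i) j)

lemma exists_toLMat {m : ℕ} {Y : LMat r} (h : Y ∈ regMat r) (h' : Y ∈ lfilt r m) :
    ∃ A ∈ filt r (m + 1), toLMat r A = Y := by
  choose A hA hAY using fun i j => exists_toLaurent (m := m + 1 + wt j - wt i)
    (by have := wt_le_one i; omega) (h i j) (h' i j)
  exact ⟨A, hA, by ext1 i j; exact hAY i j⟩

/-- Coefficients of the scalar bracket kernel: the Laurent polynomial `ρ` such that the coefficient
of `x ^ m y ^ n` in `(a(x) φ(y) - φ(x) a(y)) / (x - y)` is the residue of `a ρ`. -/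
def kernelCoeff (φ : ℂ[T;T⁻¹]) (m n : ℤ) : ℂ[T;T⁻¹] :=
  polar (φ * T (-m - 1)) * T (-n - 1) + T (-m - 1) * polar (φ * T (-n - 1)) -
    φ * (T (-m - 1) * T (-n - 1))

lemma polar_mul_T (φ : ℂ[T;T⁻¹]) (m : ℤ) :
    polar (φ * T (-m)) = polar (φ * T (-m - 1)) * T 1 - LaurentPolynomial.C (φ.coeff m) := by
  ext n
  simp only [AddMonoidAlgebra.coeff_sub, Finsupp.sub_apply, coeff_mul_T, coeff_polar,
    LaurentPolynomial.C_apply]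
  rcases lt_trichotomy n 0 with h | h | h
  · rw [if_pos h, if_pos (by omega), if_neg h.ne]
    simp only [sub_zero]
    congr 1
    ring
  · subst h
    have e : (-1 - (-m - 1) : ℤ) = m := by ring
    simp [e]
  · rw [if_neg (by omega), if_neg (by omega), if_neg h.ne']
    simp

lemma kernelCoeff_rec (φ : ℂ[T;T⁻¹]) (m n : ℤ) :
    kernelCoeff φ (m - 1) n - kernelCoeff φ m (n - 1) =
      LaurentPolynomial.C (φ.coeff n) * T (-m - 1) -
        LaurentPolynomial.C (φ.coeff m) * T (-n - 1) := by
  have e : ∀ m : ℤ, -(m - 1) - 1 = -m := fun m => by ring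
  have e2 : ∀ m : ℤ, (T (-m) : ℂ[T;T⁻¹]) = T (-m - 1) * T 1 := fun m => by
    rw [← T_add]; congr 1; ring
  simp only [kernelCoeff, e, polar_mul_T φ m, polar_mul_T φ n]
  rw [e2 m, e2 n]
  ring

lemma kernelCoeff_neg_one (φ : ℂ[X]) (n : ℕ) : kernelCoeff (toLaurent φ) (-1) n ∈ regPart := by
  have h : polar (toLaurent φ * T (-(-1) - 1)) = 0 := by
    refine polar_eq_zero ?_
    simpa using toLaurent_mem_regPart φ
  have := regPart.neg_mem (sub_polar_mem (toLaurent φ * T (-n - 1)))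
  convert this using 1
  rw [kernelCoeff, h]
  simp

lemma coeff_divDiff_rec (φ a : ℂ[X]) (n : ℕ) :
    ((divDiff φ a).coeff n).coeff 0 = φ.coeff 0 * a.coeff (n + 1) - a.coeff 0 * φ.coeff (n + 1) ∧
    ∀ m, ((divDiff φ a).coeff n).coeff (m + 1) = ((divDiff φ a).coeff (n + 1)).coeff m +
      φ.coeff (m + 1) * a.coeff (n + 1) - a.coeff (m + 1) * φ.coeff (n + 1) := by
  have h := congrArg (fun P => P.coeff (n + 1)) (divDiff_mul φ a)
  simp only [sub_mul, coeff_sub, coeff_C_mul, coeff_X_mul, coeff_map] at h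
  constructor
  · have := congrArg (fun P => P.coeff 0) h
    simp at this
    linear_combination -this
  · intro m
    have := congrArg (fun P => P.coeff (m + 1)) h
    simp at this
    linear_combination -this

/-- Both sides satisfy the recursion which expresses the defining identity of `divDiff` in terms of
coefficients. -/
lemma coeff_divDiff (φ a : ℂ[X]) (m n : ℕ) : ((divDiff φ a).coeff n).coeff m =
    (toLaurent a * kernelCoeff (toLaurent φ) m n).coeff (-1) := by
  have hrec : ∀ m n : ℕ, (toLaurent a * kernelCoeff (toLaurent φ) m n).coeff (-1) =
      (toLaurent a * kernelCoeff (toLaurent φ) ((m : ℤ) - 1) (n + 1 : ℕ)).coeff (-1) -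
        (a.coeff m * φ.coeff (n + 1) - φ.coeff m * a.coeff (n + 1)) := by
    intro m n
    have h := congrArg (fun f => (toLaurent a * f).coeff (-1))
      (kernelCoeff_rec (toLaurent φ) m (n + 1 : ℕ))
    have e : (((n + 1 : ℕ) : ℤ) - 1) = n := by push_cast; ring
    have hc : ∀ (c : ℂ) (k : ℕ), (toLaurent a * (LaurentPolynomial.C c * T (-k - 1))).coeff (-1) =
        c * a.coeff k := by
      intro c k
      rw [mul_left_comm, ← LaurentPolynomial.smul_eq_C_mul, AddMonoidAlgebra.coeff_smul,
        Finsupp.smul_apply, coeff_mul_T, ← coeff_toLaurent_natCast, smul_eq_mul]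
      congr 2
      ring
    simp only [mul_sub, AddMonoidAlgebra.coeff_sub, Finsupp.sub_apply, e, hc,
      coeff_toLaurent_natCast] at h
    linear_combination -h
  induction m generalizing n with
  | zero =>
    rw [hrec, (coeff_divDiff_rec φ a n).1]
    have : (toLaurent a * kernelCoeff (toLaurent φ) (-1) (n + 1 : ℕ)).coeff (-1) = 0 :=
      regPart_mul (toLaurent_mem_regPart a) (kernelCoeff_neg_one φ _) _ (by omega)
    simp only [Nat.cast_zero, zero_sub, this]
    ring
  | succ m ih =>
    rw [hrec, (coeff_divDiff_rec φ a n).2, ih]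
    have e : (((m + 1 : ℕ) : ℤ) - 1) = m := by push_cast; ring
    rw [e]
    ring

/-! ### The truncated bracket as a residue pairing -/

/-- The Laurent matrix representing the coordinate functional `A_{ij;m}` under the residue
pairing. -/
def dualCoord (c : Coord r d) : LMat r := Matrix.single c.1.2 c.1.1 (T (-(c.2 : ℕ) - 1))

/-- The Laurent matrix representing the linear functional on `M'` with coefficients `α`. -/
def dualMat (α : Coord r d → ℂ) : LMat r := ∑ c, α c • dualCoord c

lemma pair_dualCoord (A : MPrime r d) (c : Coord r d) :
    pair (toLMat r A.1) (dualCoord c) = coord A c := by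
  rw [dualCoord, pair_single, toLMat_apply, coord, ← coeff_toLaurent_natCast]
  congr 2
  ring

lemma pair_dualMat (A : MPrime r d) (α : Coord r d → ℂ) :
    pair (toLMat r A.1) (dualMat α) = ∑ c, coord A c * α c := by
  simp only [dualMat, map_sum, map_smul, pair_dualCoord, smul_eq_mul, mul_comm]

lemma pair_single_right (A : LMat r) (i j : Fin r) (f : ℂ[T;T⁻¹]) :
    pair A (Matrix.single j i f) = (A i j * f).coeff (-1) := by
  rw [pair_apply, Matrix.trace_mul_comm, Matrix.trace_single_mul, smul_eq_mul, mul_comm]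

lemma rOp_single (φ f : ℂ[T;T⁻¹]) (i j : Fin r) :
    rOp φ (Matrix.single i j f) = Matrix.single i j (polar (φ * f)) := by
  ext1 k l
  rw [rOp, polarMat_apply, Matrix.smul_apply, Matrix.single_apply, Matrix.single_apply]
  split_ifs <;> simp

lemma coordBracket_eq_pair (φ : ℂ[X]) (a b : Coord r d) (A : MPrime r d) :
    coordBracket φ a b A =
      pair (toLMat r A.1) (rBracket (toLaurent φ) (dualCoord a) (dualCoord b)) := by
  obtain ⟨⟨i, j⟩, m⟩ := a
  obtain ⟨⟨k, l⟩, n⟩ := b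
  have hlie : ∀ (s t : ℂ[T;T⁻¹]), ⁅Matrix.single j i s, Matrix.single l k t⁆ =
      (if i = l then Matrix.single j k (s * t) else 0) -
        (if k = j then Matrix.single l i (s * t) else 0) := by
    intro s t
    rw [Ring.lie_def]
    congr 1
    · split_ifs with h
      · rw [h, Matrix.single_mul_single_same]
      · rw [Matrix.single_mul_single_of_ne _ _ _ _ h]
    · split_ifs with h
      · rw [h, Matrix.single_mul_single_same, mul_comm]
      · rw [Matrix.single_mul_single_of_ne _ _ _ _ h]
  have key : rBracket (toLaurent φ) (dualCoord ⟨(i, j), m⟩ : LMat r) (dualCoord ⟨(k, l), n⟩) =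
      (if i = l then Matrix.single j k (kernelCoeff (toLaurent φ) m n) else 0) -
        (if k = j then Matrix.single l i (kernelCoeff (toLaurent φ) m n) else 0) := by
    have hsm : ∀ (u v : Fin r) (f : ℂ[T;T⁻¹]), toLaurent φ • Matrix.single u v f =
        Matrix.single u v (toLaurent φ * f) := fun u v f => by
      rw [Matrix.smul_single, smul_eq_mul]
    have hsub : ∀ (u v : Fin r) (f f' : ℂ[T;T⁻¹]), Matrix.single u v (f - f') =
        Matrix.single u v f - Matrix.single u v f' := fun u v f f' =>
      map_sub (Matrix.singleAddMonoidHom u v) f f'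
    simp only [rBracket, dualCoord, rOp_single, hlie, kernelCoeff]
    split_ifs <;>
      simp only [sub_zero, zero_sub, smul_sub, smul_neg, smul_zero, hsm, Matrix.single_add,
        hsub] <;> abel
  rw [key, coordBracket, map_sub]
  have hdd : ∀ p : ℂ[X], ((divDiff φ p).coeff n).coeff m =
    (toLaurent p * kernelCoeff (toLaurent φ) m n).coeff (-1) := fun p => coeff_divDiff φ p m n
  have h0 : ((0 : ℂ[X][X]).coeff n).coeff m = 0 := by simp
  rw [coeff_sub, coeff_sub]
  congr 1
  · dsimp only
    split_ifs
    · rw [hdd, pair_single_right, toLMat_apply]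
    · simp
  · dsimp only
    split_ifs
    · rw [hdd, pair_single_right, toLMat_apply]
    · simp

/-- The truncated bracket of two covectors at `A`. -/
def poissonForm (φ : ℂ[X]) (A : MPrime r d) (α β : Coord r d → ℂ) : ℂ :=
  ∑ a, ∑ b, coordBracket φ a b A * α a * β b

lemma poissonForm_eq_pair (φ : ℂ[X]) (A : MPrime r d) (α β : Coord r d → ℂ) :
    poissonForm φ A α β =
      pair (toLMat r A.1) (rBracket (toLaurent φ) (dualMat α) (dualMat β)) := by
  change _ = pair _ (rBracketₗ (toLaurent φ) (dualMat α) (dualMat β))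
  simp only [poissonForm, dualMat, map_sum, LinearMap.sum_apply, map_smul, LinearMap.smul_apply,
    smul_eq_mul]
  rw [Finset.sum_comm]
  refine Finset.sum_congr rfl fun b _ => ?_
  rw [Finset.mul_sum]
  refine Finset.sum_congr rfl fun a _ => ?_
  rw [coordBracket_eq_pair]
  change _ = _ * (_ * pair _ (rBracket _ _ _))
  ring

lemma coordBracket_skew (φ : ℂ[X]) (a b : Coord r d) (A : MPrime r d) :
    coordBracket φ a b A = -coordBracket φ b a A := by
  rw [coordBracket_eq_pair, rBracket_skew, map_neg, coordBracket_eq_pair]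

/-- The covector `α` annihilates all infinitesimal gauge transformations `[A, ξ]` at `A`. -/
def Annihilates (A : MPrime r d) (α : Coord r d → ℂ) : Prop :=
  ∀ ξ ∈ filt r 1, ∀ V : MPrime r d, V.1 = A.1 * ξ - ξ * A.1 → ∑ c, coord V c * α c = 0

lemma toLMat_mPrime_mem (A : MPrime r d) : toLMat r A.1 ∈ lfilt r d :=
  toLMat_mem_lfilt ((mem_mPrime_iff _).1 A.2)

lemma Annihilates.stationary {A : MPrime r d} {α : Coord r d → ℂ} (h : Annihilates A α) :
    Stationary (toLMat r A.1) (dualMat α) := by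
  intro ξ hξ hξ'
  obtain ⟨ξ, hξ0, rfl⟩ := exists_toLMat (m := 0) hξ hξ'
  have h1 := lfilt_lie (toLMat_mPrime_mem A) hξ'
  rw [add_zero] at h1
  obtain ⟨V, hV, hVe⟩ := exists_toLMat (m := d) (regMat_lie (toLMat_mem_reg A.1) hξ) h1
  have h2 := h ξ hξ0 ⟨V, (mem_mPrime_iff _).2 hV⟩ (toLMat_injective (by
    rw [hVe, Ring.lie_def, map_sub, map_mul, map_mul]))
  rw [← hVe, pair_comm]
  rw [← pair_dualMat] at h2
  exact h2

lemma toLaurent_mem_ordLE_of_degreeLE {φ : ℂ[X]}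
    (hφ : φ ∈ degreeLE ℂ ((d + 2 : ℕ) : WithBot ℕ)) : toLaurent φ ∈ ordLE (d + 2) := by
  rw [← degreeLT_succ_eq_degreeLE] at hφ
  exact toLaurent_mem_ordLE (by push_cast; omega) hφ

/-- The Hamiltonian vector field of a stationary functional is tangent to `M'`. -/
lemma Stationary.exists_toLMat_eq_hamField {φ : ℂ[X]}
    (hφ : φ ∈ degreeLE ℂ ((d + 2 : ℕ) : WithBot ℕ)) {A : MPrime r d} {c : LMat r} (h : Stationary (toLMat r A.1) c) :
    ∃ V : MPrime r d, toLMat r V.1 = hamField (toLaurent φ) (toLMat r A.1) c := by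
  obtain ⟨V, hV, hVe⟩ := exists_toLMat (m := d)
    (hamField_mem_reg (toLaurent_mem_regPart φ) (toLMat_mem_reg A.1) c)
    (h.hamField_mem_lfilt (toLaurent_mem_ordLE_of_degreeLE hφ) (toLMat_mPrime_mem A))
  exact ⟨⟨V, (mem_mPrime_iff _).2 hV⟩, hVe⟩

lemma isGauge_groupG (g : groupG r) : IsGauge (toLMat r g.1.1) (toLMat r (g.1⁻¹).1) where
  reg := toLMat_mem_reg _
  filt := toLMat_mem_lfilt (m := 0) ((hasShape_iff _).1 g.2).2
  reg' := toLMat_mem_reg _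
  filt' := toLMat_mem_lfilt (m := 0) ((hasShape_iff _).1 (g⁻¹).2).2
  mul_eq := by rw [← map_mul, Units.mul_inv, map_one]
  mul_eq' := by rw [← map_mul, Units.inv_mul, map_one]

lemma toLMat_conj (g : groupG r) (A : MPrime r d) :
    toLMat r (conj g A).1 = toLMat r (g.1⁻¹).1 * toLMat r A.1 * toLMat r g.1.1 := by
  rw [← map_mul, ← map_mul]; rfl

/-- Equivariance of the truncated bracket on annihilating covectors. -/
lemma poissonForm_conj {φ : ℂ[X]} (hφ : φ ∈ degreeLE ℂ ((d + 2 : ℕ) : WithBot ℕ))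
    {A : MPrime r d} (g : groupG r) {α β α' β' : Coord r d → ℂ}
    (hα : Annihilates A α) (hβ : Annihilates A β) (hβ' : Annihilates (conj g A) β')
    (hαα : ∀ V : MPrime r d, ∑ c, coord (conj g V) c * α' c = ∑ c, coord V c * α c)
    (hββ : ∀ V : MPrime r d, ∑ c, coord (conj g V) c * β' c = ∑ c, coord V c * β c) :
    poissonForm φ (conj g A) α' β' = poissonForm φ A α β := by
  have hg := isGauge_groupG g
  set h' := toLMat r (g.1⁻¹).1
  set g' := toLMat r g.1.1
  -- the dual matrices of the transported covectors are the transported dual matrices, as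
  -- functionals on `M'`
  have key : ∀ α α' : Coord r d → ℂ,
      (∀ V : MPrime r d, ∑ c, coord (conj g V) c * α' c = ∑ c, coord V c * α c) →
      ∀ V : MPrime r d, pair (dualMat α') (toLMat r V.1) =
        pair (h' * dualMat α * g') (toLMat r V.1) := by
    intro α α' hα V
    have h1 := hα (conj g⁻¹ V)
    have e : conj g (conj g⁻¹ V) = V := by rw [← conj_mul, inv_mul_cancel, conj_one]
    rw [e, ← pair_dualMat, ← pair_dualMat] at h1
    have h2 := toLMat_conj g (conj g⁻¹ V)
    rw [e] at h2
    rw [pair_comm, h1, pair_comm (h' * _ * _), h2, pair_conj hg.mul_eq]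
  have hbc := hα.stationary.conj hg
  have hcc := hβ'.stationary
  rw [← toLMat_conj] at hbc
  rw [poissonForm_eq_pair, poissonForm_eq_pair,
    ← hα.stationary.pair_rBracket_conj hg hβ.stationary, ← toLMat_conj]
  obtain ⟨V, hV⟩ := hcc.exists_toLMat_eq_hamField hφ
  obtain ⟨W, hW⟩ := hbc.exists_toLMat_eq_hamField hφ
  calc _ = pair (dualMat α') (hamField (toLaurent φ) (toLMat r (conj g A).1) (dualMat β')) :=
        pair_rBracket ..
    _ = pair (h' * dualMat α * g')
          (hamField (toLaurent φ) (toLMat r (conj g A).1) (dualMat β')) := by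
        rw [← hV, key α α' hαα]
    _ = -pair (toLMat r (conj g A).1)
          (rBracket (toLaurent φ) (dualMat β') (h' * dualMat α * g')) := by
        rw [← pair_rBracket, rBracket_skew, map_neg]
    _ = -pair (h' * dualMat β * g')
          (hamField (toLaurent φ) (toLMat r (conj g A).1) (h' * dualMat α * g')) := by
        rw [pair_rBracket, ← hW, key β β' hββ]
    _ = _ := by rw [← pair_rBracket, rBracket_skew, map_neg, neg_neg]

lemma coord_coordVec (c c' : Coord r d) : coord (coordVec c) c' = if c = c' then 1 else 0 := by
  obtain ⟨⟨i, j⟩, m⟩ := c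
  obtain ⟨⟨k, l⟩, n⟩ := c'
  simp only [coord, coordVec, Matrix.single_apply]
  by_cases h : i = k ∧ j = l
  · obtain ⟨rfl, rfl⟩ := h
    simp [coeff_monomial, Fin.ext_iff]
  · rw [if_neg h, if_neg]
    · simp
    · rintro ⟨⟩
      exact h ⟨rfl, rfl⟩

/-- The coordinates as a linear map. -/
def coordₗ (r d : ℕ) : MPrime r d →ₗ[ℂ] Coord r d → ℂ where
  toFun := coord
  map_add' A B := by funext c; simp [coord]
  map_smul' t A := by funext c; simp [coord]

lemma coord_injective : Function.Injective (coord : MPrime r d → Coord r d → ℂ) := by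
  intro A B h
  refine Subtype.ext (Matrix.ext fun i j => Polynomial.ext fun n => ?_)
  by_cases hn : n < entryLen d i j
  · exact congrFun h ⟨(i, j), ⟨n, hn⟩⟩
  · have : ∀ A : MPrime r d, (A.1 i j).coeff n = 0 := fun A =>
      coeff_eq_zero_of_degree_lt ((mem_degreeLT.1 (A.2 i j)).trans_le
        (by exact_mod_cast not_lt.1 hn))
    rw [this, this]

lemma coord_sum_smul_coordVec (v : Coord r d → ℂ) : coord (∑ c, v c • coordVec c) = v := by
  change coordₗ r d _ = v
  rw [map_sum]
  funext c'
  simp only [map_smul, Finset.sum_apply, Pi.smul_apply, smul_eq_mul]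
  change ∑ c, v c * coord (coordVec c) c' = v c'
  simp [coord_coordVec]

lemma sum_coord_smul_coordVec (A : MPrime r d) : ∑ c, coord A c • coordVec c = A :=
  coord_injective (coord_sum_smul_coordVec _)

/-- The Hamiltonian vector at `A` of a covector. -/
def hamVec (φ : ℂ[X]) (A : MPrime r d) (α : Coord r d → ℂ) : MPrime r d :=
  ∑ b, (∑ a, coordBracket φ a b A * α a) • coordVec b

/-- Hamiltonian vectors of annihilating covectors are given by the second Lie bracket, without any
truncation. -/
lemma Annihilates.pair_hamVec {φ : ℂ[X]} (hφ : φ ∈ degreeLE ℂ ((d + 2 : ℕ) : WithBot ℕ))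
    {A : MPrime r d} {α : Coord r d → ℂ} (h : Annihilates A α) (c : LMat r) :
    pair (toLMat r (hamVec φ A α).1) c =
      pair (toLMat r A.1) (rBracket (toLaurent φ) (dualMat α) c) := by
  obtain ⟨V, hV⟩ := h.stationary.exists_toLMat_eq_hamField hφ
  have hc : ∀ c, pair (toLMat r (-V).1) c =
      pair (toLMat r A.1) (rBracket (toLaurent φ) (dualMat α) c) := by
    intro c
    have : toLMat r (-V).1 = -toLMat r V.1 := map_neg (toLMat r) V.1
    rw [this, hV, rBracket_skew, map_neg, map_neg, LinearMap.neg_apply, pair_rBracket, pair_comm]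
  suffices hamVec φ A α = -V by rw [this, hc]
  refine coord_injective ?_
  rw [hamVec, coord_sum_smul_coordVec]
  funext b
  rw [← pair_dualCoord, hc]
  change _ = pair _ (rBracketₗ (toLaurent φ) (dualMat α) (dualCoord b))
  simp only [dualMat, map_sum, LinearMap.sum_apply, map_smul, LinearMap.smul_apply, smul_eq_mul]
  refine Finset.sum_congr rfl fun a _ => ?_
  rw [coordBracket_eq_pair, mul_comm]
  rfl

/-- The first order part of the Jacobi identity. -/
lemma poissonForm_hamVec_jacobi {φ : ℂ[X]} (hφ : φ ∈ degreeLE ℂ ((d + 2 : ℕ) : WithBot ℕ))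
    {A : MPrime r d} {α β γ : Coord r d → ℂ} (hα : Annihilates A α) (hβ : Annihilates A β)
    (hγ : Annihilates A γ) :
    poissonForm φ (hamVec φ A α) β γ + poissonForm φ (hamVec φ A β) γ α +
      poissonForm φ (hamVec φ A γ) α β = 0 := by
  rw [poissonForm_eq_pair, poissonForm_eq_pair, poissonForm_eq_pair, hα.pair_hamVec hφ,
    hβ.pair_hamVec hφ, hγ.pair_hamVec hφ, ← map_add, ← map_add, rBracket_jacobi, map_zero]

end

open Polynomial TopologicalSpace Filter Topology

variable {r d : ℕ}

/-! ### Calculus of regular functions -/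

lemma coord_add_smul (A V : MPrime r d) (t : ℂ) : coord (A + t • V) = coord A + t • coord V := by
  have h := (coordₗ r d).map_add A (t • V)
  rw [map_smul] at h
  exact h

lemma hasDerivAt_evalAt (A V : MPrime r d) (p : MvPolynomial (Coord r d) ℂ) :
    HasDerivAt (fun t : ℂ => evalAt (A + t • V) p)
      (∑ c, coord V c * evalAt A (MvPolynomial.pderiv c p)) 0 := by
  unfold evalAt
  simp only [coord_add_smul]
  induction p using MvPolynomial.induction_on with
  | C a => simpa using hasDerivAt_const (0 : ℂ) a
  | add p q hp hq =>
    simp only [map_add, mul_add, Finset.sum_add_distrib]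
    exact hp.add hq
  | mul_X p i hp =>
    have hX : HasDerivAt (fun t : ℂ => coord A i + t * coord V i) (coord V i) 0 := by
      simpa using ((hasDerivAt_id (0 : ℂ)).mul_const (coord V i)).const_add (coord A i)
    have h := hp.mul hX
    simp only [map_mul, MvPolynomial.eval_X, Pi.add_apply, Pi.smul_apply, smul_eq_mul]
    refine h.congr_deriv ?_
    simp only [Derivation.leibniz, MvPolynomial.pderiv_X, smul_eq_mul, map_add, map_mul,
      MvPolynomial.eval_X, mul_add, Finset.sum_add_distrib, zero_mul, add_zero, zero_smul]
    rw [add_comm, Finset.sum_mul]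
    congr 1
    · rw [Finset.sum_eq_single i]
      · simp [mul_comm]
      · intro c _ hc
        simp [hc.symm]
      · simp
    · exact Finset.sum_congr rfl fun c _ => by ring

lemma isOpen_evalAt_ne (q : MvPolynomial (Coord r d) ℂ) :
    IsOpen {A : MPrime r d | evalAt A q ≠ 0} := isTopologicalBasis_zariski.isOpen ⟨q, rfl⟩

/-- Lines are continuous from the classical to the Zariski topology. -/
lemma tendsto_line (A V : MPrime r d) : Tendsto (fun t : ℂ => A + t • V) (𝓝 0) (𝓝 A) := by
  rw [isTopologicalBasis_zariski.nhds_hasBasis.tendsto_right_iff]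
  rintro _ ⟨⟨q, rfl⟩, hq⟩
  have h := (hasDerivAt_evalAt A V q).continuousAt
  refine h.eventually_ne ?_
  simpa using hq

/-- `D` contains a neighbourhood, in the classical topology, of each of its points on every line
through this point, and `t ↦ A + t V` is continuous at `0` for the Zariski topology of `D`. -/
def LineOpen (D : Set (MPrime r d)) : Prop :=
  ∀ A ∈ D, ∀ V, Tendsto (fun t : ℂ => A + t • V) (𝓝 0) (𝓝[D] A)

lemma LineOpen.of_isOpen {D : Set (MPrime r d)} (hD : IsOpen D) : LineOpen D := fun A hA V => by
  rw [hD.nhdsWithin_eq hA]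
  exact tendsto_line A V

/-- `F` is regular at `A` as a function on `D`: on a Zariski neighbourhood of `A` in `D` it is a
quotient of polynomials. -/
def RegAt (D : Set (MPrime r d)) (F : MPrime r d → ℂ) (A : MPrime r d) : Prop :=
  ∃ p q : MvPolynomial (Coord r d) ℂ, ∀ᶠ B in 𝓝[D] A,
    evalAt B q ≠ 0 ∧ F B = evalAt B p / evalAt B q

variable {D : Set (MPrime r d)} {F G H : MPrime r d → ℂ} {A : MPrime r d}

lemma RegAt.evalAt (p : MvPolynomial (Coord r d) ℂ) : RegAt D (fun B => BV.evalAt B p) A :=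
  ⟨p, 1, Eventually.of_forall fun B => by simp [BV.evalAt]⟩

lemma RegAt.add (hF : RegAt D F A) (hG : RegAt D G A) : RegAt D (fun B => F B + G B) A := by
  obtain ⟨p, q, h⟩ := hF
  obtain ⟨p', q', h'⟩ := hG
  refine ⟨p * q' + q * p', q * q', ?_⟩
  filter_upwards [h, h'] with B h1 h2
  rw [h1.2, h2.2]
  have h3 := h1.1
  have h4 := h2.1
  simp only [BV.evalAt, map_mul, map_add] at h3 h4 ⊢
  exact ⟨mul_ne_zero h3 h4, by field_simp⟩

lemma RegAt.mul (hF : RegAt D F A) (hG : RegAt D G A) : RegAt D (fun B => F B * G B) A := by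
  obtain ⟨p, q, h⟩ := hF
  obtain ⟨p', q', h'⟩ := hG
  refine ⟨p * p', q * q', ?_⟩
  filter_upwards [h, h'] with B h1 h2
  rw [h1.2, h2.2]
  have h3 := h1.1
  have h4 := h2.1
  simp only [BV.evalAt, map_mul] at h3 h4 ⊢
  exact ⟨mul_ne_zero h3 h4, by field_simp⟩

lemma RegAt.sum {ι : Type*} (s : Finset ι) {f : ι → MPrime r d → ℂ}
    (hf : ∀ i, RegAt D (f i) A) : RegAt D (fun B => ∑ i ∈ s, f i B) A := by
  classical
  induction s using Finset.induction_on with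
  | empty => simpa [BV.evalAt] using RegAt.evalAt (D := D) (A := A) 0
  | insert i s hi ih =>
    simp only [Finset.sum_insert hi]
    exact (hf i).add ih

/-- The quotient rule along a line, for a function which is a quotient of polynomials near `A`. -/
lemma hasDerivAt_of_quotient (hD : LineOpen D) (hA : A ∈ D) {p q : MvPolynomial (Coord r d) ℂ}
    (h : ∀ᶠ B in 𝓝[D] A, evalAt B q ≠ 0 ∧ F B = evalAt B p / evalAt B q) (V : MPrime r d) :
    HasDerivAt (fun t : ℂ => F (A + t • V))
      (∑ c, coord V c * (evalAt A (MvPolynomial.pderiv c p * q - p * MvPolynomial.pderiv c q) /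
        evalAt A (q ^ 2))) 0 := by
  have hA' := h.self_of_nhdsWithin hA
  have h1 := (hasDerivAt_evalAt A V p).div (hasDerivAt_evalAt A V q) (by simpa using hA'.1)
  refine (h1.congr_of_eventuallyEq ?_).congr_deriv ?_
  · filter_upwards [(hD A hA V).eventually h] with t ht using ht.2
  · simp only [zero_smul, add_zero]
    simp only [evalAt, map_sub, map_mul, map_pow]
    rw [Finset.sum_mul, Finset.mul_sum, ← Finset.sum_sub_distrib, Finset.sum_div]
    exact Finset.sum_congr rfl fun c _ => by ring

lemma partialD_of_quotient (hD : LineOpen D) (hA : A ∈ D) {p q : MvPolynomial (Coord r d) ℂ}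
    (h : ∀ᶠ B in 𝓝[D] A, evalAt B q ≠ 0 ∧ F B = evalAt B p / evalAt B q) (c : Coord r d) :
    partialD c F A = evalAt A (MvPolynomial.pderiv c p * q - p * MvPolynomial.pderiv c q) /
      evalAt A (q ^ 2) := by
  rw [partialD, (hasDerivAt_of_quotient hD hA h (coordVec c)).deriv]
  simp [coord_coordVec]

lemma RegAt.hasDerivAt (hD : LineOpen D) (hA : A ∈ D) (hF : RegAt D F A) (V : MPrime r d) :
    HasDerivAt (fun t : ℂ => F (A + t • V)) (∑ c, coord V c * partialD c F A) 0 := by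
  obtain ⟨p, q, h⟩ := hF
  simpa only [partialD_of_quotient hD hA h] using hasDerivAt_of_quotient hD hA h V

lemma RegAt.hasDerivAt_coordVec (hD : LineOpen D) (hA : A ∈ D) (hF : RegAt D F A)
    (c : Coord r d) : HasDerivAt (fun t : ℂ => F (A + t • coordVec c)) (partialD c F A) 0 := by
  simpa [coord_coordVec] using hF.hasDerivAt hD hA (coordVec c)

lemma eventually_partialD_eq (hD : LineOpen D) {p q : MvPolynomial (Coord r d) ℂ}
    (h : ∀ᶠ B in 𝓝[D] A, evalAt B q ≠ 0 ∧ F B = evalAt B p / evalAt B q) (c : Coord r d) :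
    ∀ᶠ B in 𝓝[D] A, evalAt B (q ^ 2) ≠ 0 ∧ partialD c F B =
      evalAt B (MvPolynomial.pderiv c p * q - p * MvPolynomial.pderiv c q) / evalAt B (q ^ 2) := by
  filter_upwards [eventually_eventually_nhdsWithin.2 h, self_mem_nhdsWithin, h] with B h1 hB h2
  exact ⟨by rw [evalAt, map_pow]; exact pow_ne_zero _ h2.1, partialD_of_quotient hD hB h1 c⟩

lemma RegAt.partialD (hD : LineOpen D) (hF : RegAt D F A) (c : Coord r d) :
    RegAt D (BV.partialD c F) A := by
  obtain ⟨p, q, h⟩ := hF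
  exact ⟨_, _, eventually_partialD_eq hD h c⟩

lemma partialD_congr (hD : LineOpen D) (hA : A ∈ D) (h : F =ᶠ[𝓝[D] A] G) (c : Coord r d) :
    partialD c F A = partialD c G A :=
  Filter.EventuallyEq.deriv_eq ((hD A hA (coordVec c)).eventually h)

lemma partialD_add (hD : LineOpen D) (hA : A ∈ D) (hF : RegAt D F A) (hG : RegAt D G A)
    (c : Coord r d) : partialD c (fun B => F B + G B) A = partialD c F A + partialD c G A :=
  ((hF.hasDerivAt_coordVec hD hA c).add (hG.hasDerivAt_coordVec hD hA c)).deriv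

lemma partialD_mul (hD : LineOpen D) (hA : A ∈ D) (hF : RegAt D F A) (hG : RegAt D G A)
    (c : Coord r d) :
    partialD c (fun B => F B * G B) A = partialD c F A * G A + F A * partialD c G A := by
  have h := ((hF.hasDerivAt_coordVec hD hA c).fun_mul (hG.hasDerivAt_coordVec hD hA c)).deriv
  simp only [zero_smul, add_zero] at h
  exact h

lemma partialD_const_mul (t : ℂ) (c : Coord r d) :
    partialD c (fun B => t * F B) A = t * partialD c F A :=
  deriv_const_mul_field t

lemma partialD_sum (hD : LineOpen D) (hA : A ∈ D) {ι : Type*} (s : Finset ι)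
    {f : ι → MPrime r d → ℂ} (hf : ∀ i, RegAt D (f i) A) (c : Coord r d) :
    partialD c (fun B => ∑ i ∈ s, f i B) A = ∑ i ∈ s, partialD c (f i) A :=
  (HasDerivAt.fun_sum fun i _ => (hf i).hasDerivAt_coordVec hD hA c).deriv

lemma pderiv_pderiv_comm {σ : Type*} (a b : σ) (s : MvPolynomial σ ℂ) :
    MvPolynomial.pderiv a (MvPolynomial.pderiv b s) =
      MvPolynomial.pderiv b (MvPolynomial.pderiv a s) := by
  classical
  have h1 : ⁅MvPolynomial.pderiv (R := ℂ) a, MvPolynomial.pderiv (R := ℂ) b⁆ = 0 := by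
    refine MvPolynomial.derivation_ext fun i => ?_
    rw [Derivation.commutator_apply, MvPolynomial.pderiv_X, MvPolynomial.pderiv_X]
    simp only [Pi.single_apply]
    split_ifs <;> simp
  have h2 := Derivation.congr_fun h1 s
  rw [Derivation.commutator_apply] at h2
  exact sub_eq_zero.1 h2

lemma pderiv_quotient_comm {σ : Type*} (a b : σ) (p q : MvPolynomial σ ℂ) :
    MvPolynomial.pderiv a (MvPolynomial.pderiv b p * q - p * MvPolynomial.pderiv b q) * q ^ 2 -
        (MvPolynomial.pderiv b p * q - p * MvPolynomial.pderiv b q) *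
          MvPolynomial.pderiv a (q ^ 2) =
      MvPolynomial.pderiv b (MvPolynomial.pderiv a p * q - p * MvPolynomial.pderiv a q) * q ^ 2 -
        (MvPolynomial.pderiv a p * q - p * MvPolynomial.pderiv a q) *
          MvPolynomial.pderiv b (q ^ 2) := by
  simp only [map_sub, pow_two, MvPolynomial.pderiv_mul, pderiv_pderiv_comm a b]
  ring

lemma partialD_comm (hD : LineOpen D) (hA : A ∈ D) (hF : RegAt D F A) (a b : Coord r d) :
    partialD a (partialD b F) A = partialD b (partialD a F) A := by
  obtain ⟨p, q, h⟩ := hF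
  have h1 := partialD_of_quotient hD hA (eventually_partialD_eq hD h b) a
  have h2 := partialD_of_quotient hD hA (eventually_partialD_eq hD h a) b
  rw [h1, h2, pderiv_quotient_comm]

/-! ### The truncated bracket of invariant functions -/

/-- The gradient in the coordinates `A_{ij;k}`. -/
def grad (F : MPrime r d → ℂ) (A : MPrime r d) (c : Coord r d) : ℂ := partialD c F A

/-- The value of the truncated bracket of two coordinate functions, as a linear function. -/
def coordBracketₗ (φ : ℂ[X]) (a b : Coord r d) : MPrime r d →ₗ[ℂ] ℂ :=
  pair.flip (rBracket (toLaurent φ) (dualCoord a) (dualCoord b)) ∘ₗ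
    (toLMat r).toLinearMap ∘ₗ (mPrime r d).subtype

lemma coordBracketₗ_apply (φ : ℂ[X]) (a b : Coord r d) (A : MPrime r d) :
    coordBracketₗ φ a b A = coordBracket φ a b A := (coordBracket_eq_pair φ a b A).symm

lemma coordBracket_eq_sum (φ : ℂ[X]) (a b : Coord r d) (A : MPrime r d) :
    coordBracket φ a b A = ∑ c, coord A c * coordBracket φ a b (coordVec c) := by
  conv_lhs => rw [← coordBracketₗ_apply, ← sum_coord_smul_coordVec A, map_sum]
  simp only [map_smul, smul_eq_mul, coordBracketₗ_apply]

lemma RegAt.coordBracket (φ : ℂ[X]) (a b : Coord r d) : RegAt D (BV.coordBracket φ a b) A := by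
  have h := RegAt.evalAt (D := D) (A := A)
    (∑ c, MvPolynomial.X c * MvPolynomial.C (BV.coordBracket φ a b (coordVec c)))
  convert h using 2 with B
  rw [coordBracket_eq_sum]
  simp [BV.evalAt]

lemma partialD_coordBracket (φ : ℂ[X]) (a b c : Coord r d) (A : MPrime r d) :
    partialD c (coordBracket φ a b) A = coordBracket φ a b (coordVec c) := by
  have h : ∀ t : ℂ, coordBracket φ a b (A + t • coordVec c) =
      t * coordBracket φ a b (coordVec c) + coordBracket φ a b A := fun t => by
    simp only [← coordBracketₗ_apply, map_add, map_smul, smul_eq_mul]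
    ring
  rw [partialD]
  simp only [h]
  simp

lemma RegAt.bvBracket (hD : LineOpen D) (φ : ℂ[X]) (hF : RegAt D F A) (hH : RegAt D H A) :
    RegAt D (BV.bvBracket φ F H) A :=
  RegAt.sum _ fun a => RegAt.sum _ fun b =>
    ((RegAt.coordBracket φ a b).mul (hF.partialD hD a)).mul (hH.partialD hD b)

lemma bvBracket_congr (hD : LineOpen D) (hA : A ∈ D) {F' H' : MPrime r d → ℂ} (φ : ℂ[X])
    (hF : ∀ B ∈ D, F B = F' B) (hH : ∀ B ∈ D, H B = H' B) :
    bvBracket φ F H A = bvBracket φ F' H' A := by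
  have h1 := partialD_congr hD hA (F := F) (G := F') (eventuallyEq_nhdsWithin_of_eqOn hF)
  have h2 := partialD_congr hD hA (F := H) (G := H') (eventuallyEq_nhdsWithin_of_eqOn hH)
  simp only [bvBracket, h1, h2]

lemma bvBracket_skew (φ : ℂ[X]) (F H : MPrime r d → ℂ) (A : MPrime r d) :
    bvBracket φ F H A = -bvBracket φ H F A := by
  rw [bvBracket, bvBracket, Finset.sum_comm, ← Finset.sum_neg_distrib]
  refine Finset.sum_congr rfl fun b _ => ?_
  rw [← Finset.sum_neg_distrib]
  refine Finset.sum_congr rfl fun a _ => ?_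
  rw [coordBracket_skew]
  ring

lemma bvBracket_leibniz (hD : LineOpen D) (hA : A ∈ D) (φ : ℂ[X]) (F : MPrime r d → ℂ)
    (hG : RegAt D G A) (hH : RegAt D H A) :
    bvBracket φ F (fun B => G B * H B) A = bvBracket φ F G A * H A + G A * bvBracket φ F H A := by
  simp only [bvBracket, partialD_mul hD hA hG hH, Finset.sum_mul, Finset.mul_sum,
    ← Finset.sum_add_distrib]
  exact Finset.sum_congr rfl fun a _ => Finset.sum_congr rfl fun b _ => by ring

lemma bvBracket_add_right (hD : LineOpen D) (hA : A ∈ D) (φ : ℂ[X]) (F : MPrime r d → ℂ)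
    (hG : RegAt D G A) (hH : RegAt D H A) :
    bvBracket φ F (fun B => G B + H B) A = bvBracket φ F G A + bvBracket φ F H A := by
  simp only [bvBracket, partialD_add hD hA hG hH, ← Finset.sum_add_distrib, mul_add]

lemma bvBracket_const_mul_right (φ : ℂ[X]) (F H : MPrime r d → ℂ) (t : ℂ) (A : MPrime r d) :
    bvBracket φ F (fun B => t * H B) A = t * bvBracket φ F H A := by
  simp only [bvBracket, partialD_const_mul, Finset.mul_sum]
  exact Finset.sum_congr rfl fun a _ => Finset.sum_congr rfl fun b _ => by ring

/-- `F` takes the same value at any two points of `D` in the same orbit. -/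
def InvOn (D : Set (MPrime r d)) (F : MPrime r d → ℂ) : Prop :=
  ∀ (g : groupG r), ∀ A ∈ D, conj g A ∈ D → F (conj g A) = F A

/-- For small `t`, the matrix `1 + t η` lies in `G_r`, if `η` has the shape of an element of the
Lie algebra. -/
lemma eventually_exists_groupG {η : Matrix (Fin r) (Fin r) ℂ[X]} (hη : η ∈ filt r 1)
    (hη0 : ∀ i j : Fin r, i.val = 0 → j.val = 0 → η i j = 0) :
    ∀ᶠ t : ℂ in 𝓝 0, ∃ g : groupG r, g.1.1 = 1 + t • η := by
  have hshape : ∀ t : ℂ, HasShape (1 + t • η) := fun t => by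
    have h1 := (hasShape_iff _).1 (HasShape.one (r := r))
    refine (hasShape_iff _).2 ⟨fun i j hi hj => ?_, fun i j => (degreeLT ℂ _).add_mem (h1.2 i j)
      ((degreeLT ℂ _).smul_mem _ (hη i j))⟩
    rw [Matrix.add_apply, h1.1 i j hi hj, Matrix.smul_apply, hη0 i j hi hj, smul_zero, add_zero]
  set η₀ := η.map (eval 0) with hη₀
  have hcont : Continuous fun t : ℂ => (1 + t • η₀).det := by fun_prop
  have hne : ∀ᶠ t : ℂ in 𝓝 0, (1 + t • η₀).det ≠ 0 :=
    hcont.continuousAt.eventually_ne (by simp)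
  filter_upwards [hne] with t ht
  have hdet : (1 + t • η).det = Polynomial.C (1 + t • η₀).det := by
    rw [(hshape t).det, coeff_zero_eq_eval_zero]
    congr 1
    change evalRingHom 0 (1 + t • η).det = _
    rw [RingHom.map_det]
    congr 1
    ext i j
    by_cases hij : i = j <;> simp [hη₀, hij]
  have hu : IsUnit (1 + t • η) := by
    rw [Matrix.isUnit_iff_isUnit_det, hdet]
    exact isUnit_C.2 (isUnit_iff_ne_zero.2 ht)
  obtain ⟨u, hu⟩ := hu
  exact ⟨⟨u, show HasShape u.1 by rw [hu]; exact hshape t⟩, hu⟩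

/-- Gradients of invariant functions annihilate infinitesimal gauge transformations. With
`g = 1 + t ξ`, invariance says `F (A + t ξ A) = F (g A) = F (A g) = F (A + t A ξ)`. -/
lemma InvOn.annihilates (hD : LineOpen D) (hA : A ∈ D) (hF : RegAt D F A) (hinv : InvOn D F) :
    Annihilates A (grad F A) := by
  intro ξ hξ V hV
  -- only the part of `ξ` with vanishing upper left entry integrates to `G_r`
  obtain ⟨s, hs⟩ : ∃ s : ℂ, ∀ i j : Fin r, i.val = 0 → j.val = 0 → ξ i j = Polynomial.C s := by
    by_cases h0 : ∃ i : Fin r, i.val = 0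
    · obtain ⟨i₀, hi₀⟩ := h0
      refine ⟨(ξ i₀ i₀).coeff 0, fun i j hi hj => ?_⟩
      rw [Fin.ext (hi.trans hi₀.symm), Fin.ext (hj.trans hi₀.symm)]
      have := hξ i₀ i₀
      rw [Nat.add_sub_cancel, degreeLT_succ_eq_degreeLE, mem_degreeLE] at this
      exact eq_C_of_degree_le_zero (by simpa using this)
    · exact ⟨0, fun i _ hi => absurd ⟨i, hi⟩ h0⟩
  set η := ξ - s • 1 with hη
  have hη1 : η ∈ filt r 1 := fun i j => (degreeLT ℂ _).sub_mem (hξ i j)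
    ((degreeLT ℂ _).smul_mem _ (((hasShape_iff _).1 HasShape.one).2 i j))
  have hη0 : ∀ i j : Fin r, i.val = 0 → j.val = 0 → η i j = 0 := fun i j hi hj => by
    rw [hη, Matrix.sub_apply, hs i j hi hj, Fin.ext (hi.trans hj.symm)]
    simp [Polynomial.smul_eq_C_mul]
  have hVη : V.1 = A.1 * η - η * A.1 := by
    rw [hV, hη, mul_sub, sub_mul]
    simp
  have hmem := (mem_mPrime_iff _).1 A.2
  have e1 : d + 1 + 1 - 1 = d + 1 := by omega
  have e2 : 1 + (d + 1) - 1 = d + 1 := by omega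
  let M₁ : MPrime r d := ⟨A.1 * η, (mem_mPrime_iff _).2 (e1 ▸ filt_mul (by omega) le_rfl hmem hη1)⟩
  let M₂ : MPrime r d := ⟨η * A.1, (mem_mPrime_iff _).2 (e2 ▸ filt_mul le_rfl (by omega) hη1 hmem)⟩
  have hVM : V = M₁ - M₂ := Subtype.ext hVη
  have h1 := hF.hasDerivAt hD hA M₁
  have h2 := hF.hasDerivAt hD hA M₂
  have heq : (fun t : ℂ => F (A + t • M₁)) =ᶠ[𝓝 0] fun t : ℂ => F (A + t • M₂) := by
    filter_upwards [eventually_exists_groupG hη1 hη0,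
      (hD A hA M₁).eventually self_mem_nhdsWithin,
      (hD A hA M₂).eventually self_mem_nhdsWithin] with t ⟨g, hg⟩ ht1 ht2
    have hconj : conj g (A + t • M₂) = A + t • M₁ := by
      refine Subtype.ext ?_
      have e3 : (A + t • M₂).1 = g.1.1 * A.1 := by
        rw [hg, add_mul, one_mul, smul_mul_assoc]; rfl
      have e4 : (A + t • M₁).1 = A.1 * g.1.1 := by
        rw [hg, mul_add, mul_one, mul_smul_comm]; rfl
      change (g.1⁻¹).1 * (A + t • M₂).1 * g.1.1 = _
      rw [e3, e4, ← mul_assoc, Units.inv_mul, one_mul]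
    rw [← hconj] at ht1 ⊢
    exact hinv g _ ht2 ht1
  have h3 := h1.unique (h2.congr_of_eventuallyEq heq)
  have hc : ∀ c, coord V c = coord M₁ c - coord M₂ c := fun c => by
    rw [hVM]
    exact congrFun (map_sub (coordₗ r d) M₁ M₂) c
  simp only [hc, sub_mul, Finset.sum_sub_distrib]
  exact sub_eq_zero.2 h3

lemma conj_add_smul (g : groupG r) (A V : MPrime r d) (t : ℂ) :
    conj g (A + t • V) = conj g A + t • conj g V := by
  refine Subtype.ext ?_
  change (g.1⁻¹).1 * (A.1 + t • V.1) * g.1.1 =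
    (g.1⁻¹).1 * A.1 * g.1.1 + t • ((g.1⁻¹).1 * V.1 * g.1.1)
  rw [mul_add, add_mul, mul_smul_comm, smul_mul_assoc]

lemma InvOn.grad_conj (hD : LineOpen D) (hinv : InvOn D F) (g : groupG r) (hA : A ∈ D)
    (hgA : conj g A ∈ D) (hF : RegAt D F A) (hF' : RegAt D F (conj g A)) (V : MPrime r d) :
    ∑ c, coord (conj g V) c * grad F (conj g A) c = ∑ c, coord V c * grad F A c := by
  refine (hF'.hasDerivAt hD hgA (conj g V)).unique
    ((hF.hasDerivAt hD hA V).congr_of_eventuallyEq ?_)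
  filter_upwards [(hD A hA V).eventually self_mem_nhdsWithin,
    (hD _ hgA (conj g V)).eventually self_mem_nhdsWithin] with t h1 h2
  rw [← conj_add_smul] at h2 ⊢
  exact hinv g _ h1 h2

/-- The truncated bracket of two invariant functions is invariant. -/
lemma InvOn.bvBracket (hD : LineOpen D) {φ : ℂ[X]}
    (hφ : φ ∈ degreeLE ℂ ((d + 2 : ℕ) : WithBot ℕ)) (hF : ∀ A ∈ D, RegAt D F A)
    (hH : ∀ A ∈ D, RegAt D H A) (hF' : InvOn D F) (hH' : InvOn D H) :
    InvOn D (BV.bvBracket φ F H) := fun g A hA hgA =>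
  poissonForm_conj hφ g (hF'.annihilates hD hA (hF A hA)) (hH'.annihilates hD hA (hH A hA))
    (hH'.annihilates hD hgA (hH _ hgA))
    (hF'.grad_conj hD g hA hgA (hF _ hA) (hF _ hgA))
    (hH'.grad_conj hD g hA hgA (hH _ hA) (hH _ hgA))

/-- An iterated bracket splits into a first order part and two Hessian terms. -/
lemma bvBracket_bvBracket (hD : LineOpen D) (hA : A ∈ D) (φ : ℂ[X]) (F : MPrime r d → ℂ)
    (hG : RegAt D G A) (hH : RegAt D H A) :
    bvBracket φ F (bvBracket φ G H) A =
      poissonForm φ (hamVec φ A (grad F A)) (grad G A) (grad H A) -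
        (∑ c, ∑ a, coord (hamVec φ A (grad F A)) c * coord (hamVec φ A (grad H A)) a *
          partialD c (partialD a G) A) +
        ∑ c, ∑ b, coord (hamVec φ A (grad F A)) c * coord (hamVec φ A (grad G A)) b *
          partialD c (partialD b H) A := by
  have hham : ∀ (K : MPrime r d → ℂ) c, coord (hamVec φ A (grad K A)) c =
      ∑ a, coordBracket φ a c A * partialD a K A := fun K c =>
    congrFun (coord_sum_smul_coordVec _) c
  have hreg : ∀ a b, RegAt D
      (fun B => coordBracket φ a b B * partialD a G B * partialD b H B) A := fun a b =>
    ((RegAt.coordBracket φ a b).mul (hG.partialD hD a)).mul (hH.partialD hD b)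
  have hderiv : ∀ c, partialD c (bvBracket φ G H) A =
      ∑ a, ∑ b, (coordBracket φ a b (coordVec c) * grad G A a * grad H A b +
        coordBracket φ a b A * partialD c (partialD a G) A * partialD b H A +
        coordBracket φ a b A * partialD a G A * partialD c (partialD b H) A) := by
    intro c
    have h1 := partialD_sum hD hA Finset.univ
      (fun a => RegAt.sum Finset.univ fun b => hreg a b) c
    refine h1.trans (Finset.sum_congr rfl fun a _ => ?_)
    refine (partialD_sum hD hA Finset.univ (fun b => hreg a b) c).trans
      (Finset.sum_congr rfl fun b _ => ?_)
    rw [partialD_mul hD hA ((RegAt.coordBracket φ a b).mul (hG.partialD hD a))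
      (hH.partialD hD b), partialD_mul hD hA (RegAt.coordBracket φ a b) (hG.partialD hD a),
      partialD_coordBracket]
    simp only [grad]
    ring
  have hout : bvBracket φ F (bvBracket φ G H) A =
      ∑ c, coord (hamVec φ A (grad F A)) c * partialD c (bvBracket φ G H) A := by
    rw [bvBracket, Finset.sum_comm]
    simp only [hham, Finset.sum_mul]
  have h1 : poissonForm φ (hamVec φ A (grad F A)) (grad G A) (grad H A) =
      ∑ c, coord (hamVec φ A (grad F A)) c *
        ∑ a, ∑ b, coordBracket φ a b (coordVec c) * grad G A a * grad H A b := by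
    simp only [poissonForm, coordBracket_eq_sum φ _ _ (hamVec φ A (grad F A)), Finset.mul_sum]
    rw [Finset.sum_comm]
    refine Finset.sum_comm.trans ((Finset.sum_congr rfl fun a _ => ?_).trans Finset.sum_comm)
    rw [Finset.sum_comm]
    refine Finset.sum_congr rfl fun b _ => ?_
    rw [Finset.sum_mul, Finset.sum_mul]
    exact Finset.sum_congr rfl fun c _ => by ring
  have h2 : ∀ c, ∑ a, ∑ b, coordBracket φ a b A * partialD c (partialD a G) A * partialD b H A =
      -∑ a, coord (hamVec φ A (grad H A)) a * partialD c (partialD a G) A := by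
    intro c
    simp only [hham, Finset.sum_mul, ← Finset.sum_neg_distrib]
    refine Finset.sum_congr rfl fun a _ => Finset.sum_congr rfl fun b _ => ?_
    rw [coordBracket_skew]
    ring
  have h3 : ∀ c, ∑ a, ∑ b, coordBracket φ a b A * partialD a G A * partialD c (partialD b H) A =
      ∑ b, coord (hamVec φ A (grad G A)) b * partialD c (partialD b H) A := by
    intro c
    rw [Finset.sum_comm]
    simp only [hham, Finset.sum_mul]
  rw [hout, h1, ← Finset.sum_sub_distrib, ← Finset.sum_add_distrib]
  refine Finset.sum_congr rfl fun c _ => ?_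
  rw [hderiv]
  simp only [Finset.sum_add_distrib]
  rw [h2, h3]
  simp only [mul_assoc, ← Finset.mul_sum]
  ring

/-- The Jacobi identity for invariant functions. -/
lemma bvBracket_jacobi (hD : LineOpen D) {φ : ℂ[X]}
    (hφ : φ ∈ degreeLE ℂ ((d + 2 : ℕ) : WithBot ℕ)) (hA : A ∈ D) (hF : RegAt D F A)
    (hG : RegAt D G A) (hH : RegAt D H A) (hF' : InvOn D F) (hG' : InvOn D G) (hH' : InvOn D H) :
    bvBracket φ F (bvBracket φ G H) A + bvBracket φ G (bvBracket φ H F) A +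
      bvBracket φ H (bvBracket φ F G) A = 0 := by
  have hsymm : ∀ (u v : Coord r d → ℂ) {K : MPrime r d → ℂ}, RegAt D K A →
      ∑ c, ∑ a, u c * v a * partialD c (partialD a K) A =
        ∑ c, ∑ a, v c * u a * partialD c (partialD a K) A := by
    intro u v K hK
    rw [Finset.sum_comm]
    refine Finset.sum_congr rfl fun a _ => Finset.sum_congr rfl fun c _ => ?_
    rw [partialD_comm hD hA hK]
    ring
  rw [bvBracket_bvBracket hD hA φ F hG hH, bvBracket_bvBracket hD hA φ G hH hF,
    bvBracket_bvBracket hD hA φ H hF hG]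
  set u := coord (hamVec φ A (grad F A))
  set v := coord (hamVec φ A (grad G A))
  set w := coord (hamVec φ A (grad H A))
  rw [hsymm u w hG, hsymm v u hH, hsymm w v hF]
  linear_combination poissonForm_hamVec_jacobi hφ (hF'.annihilates hD hA hF)
    (hG'.annihilates hD hA hG) (hH'.annihilates hD hA hH)

/-! ### Irreducibility of the spectral curve is an open condition on lines -/

/-- The bivariate polynomial with given coefficients: degree at most `n` in the outer and at most
`N` in the inner variable. -/
def bivariate {n N : ℕ} (q : Fin (n + 1) × Fin (N + 1) → ℂ) : ℂ[X][X] :=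
  ∑ p, monomial p.1 (monomial p.2 (q p))

lemma coeff_bivariate {n N : ℕ} (q : Fin (n + 1) × Fin (N + 1) → ℂ) (i k : ℕ) :
    ((bivariate q).coeff i).coeff k =
      if h : i < n + 1 ∧ k < N + 1 then q (⟨i, h.1⟩, ⟨k, h.2⟩) else 0 := by
  simp only [bivariate, finsetSum_coeff, coeff_monomial]
  split_ifs with h
  · rw [Finset.sum_eq_single (⟨i, h.1⟩, ⟨k, h.2⟩)]
    · simp
    · rintro ⟨a, b⟩ - hab
      split_ifs with h1
      · rw [coeff_monomial, if_neg]
        exact fun h2 => hab (Prod.ext (Fin.ext h1) (Fin.ext h2))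
      · simp
    · simp
  · refine Finset.sum_eq_zero fun p _ => ?_
    split_ifs with h1
    · rw [coeff_monomial, if_neg]
      exact fun h2 => h ⟨h1 ▸ p.1.2, h2 ▸ p.2.2⟩
    · simp

lemma bivariate_smul {n N : ℕ} (s : ℂ) (q : Fin (n + 1) × Fin (N + 1) → ℂ) :
    bivariate (s • q) = C (C s) * bivariate q := by
  ext i k
  rw [coeff_C_mul, coeff_C_mul, coeff_bivariate, coeff_bivariate]
  split_ifs <;> simp

lemma bivariate_ne_zero {n N : ℕ} {q : Fin (n + 1) × Fin (N + 1) → ℂ} (hq : q ≠ 0) :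
    bivariate q ≠ 0 := by
  contrapose! hq
  funext ⟨i, k⟩
  have := coeff_bivariate q i k
  rw [hq, dif_pos ⟨i.2, k.2⟩] at this
  simpa using this.symm

lemma natDegree_bivariate_le {n N : ℕ} (q : Fin (n + 1) × Fin (N + 1) → ℂ) :
    (bivariate q).natDegree ≤ n := by
  rw [natDegree_le_iff_coeff_eq_zero]
  intro i hi
  ext k
  rw [coeff_bivariate, dif_neg (by omega)]
  simp

lemma exists_bivariate_eq {n N : ℕ} {f : ℂ[X][X]} (hn : f.natDegree ≤ n)
    (hN : ∀ i k, N < k → (f.coeff i).coeff k = 0) :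
    ∃ q : Fin (n + 1) × Fin (N + 1) → ℂ, bivariate q = f := by
  refine ⟨fun p => (f.coeff p.1).coeff p.2, ?_⟩
  ext i k
  rw [coeff_bivariate]
  split_ifs with h
  · rfl
  · by_cases hi : i < n + 1
    · exact (hN i k (by omega)).symm
    · have : f.coeff i = 0 := coeff_eq_zero_of_natDegree_lt (by omega)
      rw [this, coeff_zero]

lemma continuous_coeff_bivariate {n N : ℕ} (i k : ℕ) :
    Continuous fun q : Fin (n + 1) × Fin (N + 1) → ℂ => ((bivariate q).coeff i).coeff k := by
  simp only [coeff_bivariate]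
  split_ifs
  · exact continuous_apply _
  · exact continuous_const

lemma coeff_coeff_swap (f : ℂ[X][X]) (i k : ℕ) :
    ((Bivariate.swap f).coeff k).coeff i = (f.coeff i).coeff k := by
  induction f using Polynomial.induction_on' with
  | add p q hp hq => simp only [map_add, coeff_add, hp, hq]
  | monomial n a =>
    induction a using Polynomial.induction_on' with
    | add p q hp hq => simp only [map_add, coeff_add, hp, hq]
    | monomial m c =>
      rw [Bivariate.swap_monomial_monomial]
      simp only [coeff_monomial]
      split_ifs <;> simp_all [coeff_monomial]

/-- The degree in the inner variable is additive, so a factor has no larger degree. -/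
lemma coeff_coeff_eq_zero_of_dvd {f P : ℂ[X][X]} (hP : P ≠ 0) {N : ℕ}
    (hN : ∀ i k, N < k → (P.coeff i).coeff k = 0) (h : f ∣ P) (i k : ℕ) (hk : N < k) :
    (f.coeff i).coeff k = 0 := by
  have h1 : (Bivariate.swap P).natDegree ≤ N := by
    rw [natDegree_le_iff_coeff_eq_zero]
    intro k hk
    ext i
    rw [coeff_coeff_swap, hN i k hk, coeff_zero]
  obtain ⟨g, rfl⟩ := h
  have h2 : Bivariate.swap (f * g) = Bivariate.swap f * Bivariate.swap g := map_mul _ f g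
  have h3 : ∀ Q : ℂ[X][X], Q ≠ 0 → Bivariate.swap Q ≠ 0 := fun Q hQ h0 => hQ (by
    rw [← Bivariate.swap_swap_apply Q, h0, map_zero])
  rw [h2, natDegree_mul (h3 f (left_ne_zero_of_mul hP)) (h3 g (right_ne_zero_of_mul hP))] at h1
  have h4 : (Bivariate.swap f).coeff k = 0 := coeff_eq_zero_of_natDegree_lt (by omega)
  rw [← coeff_coeff_swap, h4, coeff_zero]

section

variable {P : ℂ → ℂ[X][X]} {N : ℕ}

/-- The parameters `t` for which `P t` has a factorization with factors of degrees at most `n` and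
`m` form a closed set: up to scalars, the factors range over compact unit spheres. -/
lemma isClosed_setOf_factorization (n m : ℕ)
    (hcont : ∀ i k, Continuous fun t => ((P t).coeff i).coeff k) :
    IsClosed {t | ∃ (q : Fin (n + 1) × Fin (N + 1) → ℂ) (q' : Fin (m + 1) × Fin (N + 1) → ℂ),
      ‖q‖ = 1 ∧ ‖q'‖ = 1 ∧ bivariate q * bivariate q' =
        C (C (((bivariate q * bivariate q').coeff (n + m)).coeff 0)) * P t} := by
  set S := Metric.sphere (0 : Fin (n + 1) × Fin (N + 1) → ℂ) 1
  set S' := Metric.sphere (0 : Fin (m + 1) × Fin (N + 1) → ℂ) 1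
  have hc : ∀ i k, Continuous fun z : (S × S') × ℂ =>
      ((bivariate z.1.1.1 * bivariate z.1.2.1).coeff i).coeff k := by
    intro i k
    simp only [coeff_mul, finsetSum_coeff]
    refine continuous_finsetSum _ fun x _ => continuous_finsetSum _ fun y _ => ?_
    exact ((continuous_coeff_bivariate _ _).comp (by fun_prop)).mul
      ((continuous_coeff_bivariate _ _).comp (by fun_prop))
  have hZ : IsClosed {z : (S × S') × ℂ | bivariate z.1.1.1 * bivariate z.1.2.1 =
      C (C (((bivariate z.1.1.1 * bivariate z.1.2.1).coeff (n + m)).coeff 0)) * P z.2} := by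
    simp only [Polynomial.ext_iff, coeff_C_mul, Set.ofPred_forall]
    exact isClosed_iInter fun i => isClosed_iInter fun k =>
      isClosed_eq (hc i k) ((hc _ _).mul ((hcont i k).comp continuous_snd))
  convert isClosedMap_snd_of_compactSpace _ hZ using 1
  ext t
  constructor
  · rintro ⟨q, q', hq, hq', h⟩
    exact ⟨((⟨q, by simpa [S] using hq⟩, ⟨q', by simpa [S'] using hq'⟩), t), h, rfl⟩
  · rintro ⟨⟨⟨q, q'⟩, t⟩, h, rfl⟩
    exact ⟨q.1, q'.1, mem_sphere_zero_iff_norm.1 q.2, mem_sphere_zero_iff_norm.1 q'.2, h⟩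

/-- Irreducibility is an open condition in a continuous family of monic bivariate polynomials of
bounded degrees. -/
lemma isOpen_setOf_irreducible (hr : 0 < r) (hmonic : ∀ t, (P t).Monic)
    (hdeg : ∀ t, (P t).natDegree = r) (hN : ∀ t i k, N < k → ((P t).coeff i).coeff k = 0)
    (hcont : ∀ i k, Continuous fun t => ((P t).coeff i).coeff k) :
    IsOpen {t | Irreducible (P t)} := by
  have hclosed := isClosed_biUnion_finset (s := Finset.Ioo 0 r) fun n _ =>
    isClosed_setOf_factorization (N := N) n (r - n) hcont
  convert hclosed.isOpen_compl using 1
  ext t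
  simp only [Set.mem_ofPred_eq, Set.mem_compl_iff, Set.mem_iUnion, Finset.mem_Ioo, not_exists]
  have hP1 : P t ≠ 1 := fun h => by
    have := hdeg t
    rw [h, natDegree_one] at this
    omega
  constructor
  · rintro hirr n ⟨hn0, hnr⟩ q q' ⟨hq, hq', h⟩
    have hq0 : bivariate q ≠ 0 := bivariate_ne_zero (norm_ne_zero_iff.1 (by simp [hq]))
    have hq0' : bivariate q' ≠ 0 := bivariate_ne_zero (norm_ne_zero_iff.1 (by simp [hq']))
    set c := ((bivariate q * bivariate q').coeff (n + (r - n))).coeff 0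
    have hc : c ≠ 0 := by
      intro hc
      rw [hc, C_0, C_0, zero_mul] at h
      exact mul_ne_zero hq0 hq0' h
    have hPt : P t = (C (C c⁻¹) * bivariate q) * bivariate q' := by
      rw [mul_assoc, h, ← mul_assoc, ← C_mul, ← C_mul, inv_mul_cancel₀ hc, C_1, C_1, one_mul]
    have hd := hdeg t
    have hcq : C (C c⁻¹) * bivariate q ≠ 0 :=
      mul_ne_zero (by simpa using hc) hq0
    rw [hPt, natDegree_mul hcq hq0'] at hd
    have h1 : (C (C c⁻¹) * bivariate q).natDegree ≤ n :=
      (natDegree_C_mul_le _ _).trans (natDegree_bivariate_le q)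
    have h2 := natDegree_bivariate_le q'
    rcases hirr.isUnit_or_isUnit hPt with hu | hu
    · have := natDegree_eq_zero_of_isUnit hu
      omega
    · have := natDegree_eq_zero_of_isUnit hu
      omega
  · intro h
    rw [(hmonic t).irreducible_iff_natDegree']
    refine ⟨hP1, ?_⟩
    intro f g hf hg hfg hmem
    rw [hdeg, Finset.mem_Ioc] at hmem
    have hsum : f.natDegree + g.natDegree = r := by
      rw [← hf.natDegree_mul hg, hfg, hdeg]
    have hg' : r - f.natDegree = g.natDegree := by omega
    obtain ⟨q, hq⟩ := exists_bivariate_eq (f := f) le_rfl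
      (coeff_coeff_eq_zero_of_dvd (hmonic t).ne_zero (hN t) (Dvd.intro _ hfg))
    obtain ⟨q', hq'⟩ := exists_bivariate_eq (f := g) hg'.ge
      (coeff_coeff_eq_zero_of_dvd (hmonic t).ne_zero (hN t) (Dvd.intro_left _ hfg))
    have hnorm : ∀ {n : ℕ} (q : Fin (n + 1) × Fin (N + 1) → ℂ), bivariate q ≠ 0 →
        ‖((‖q‖⁻¹ : ℝ) : ℂ) • q‖ = 1 := fun q hq0 => by
      have : ‖q‖ ≠ 0 := fun h0 => hq0 (by
        rw [norm_eq_zero.1 h0]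
        simp [bivariate])
      rw [norm_smul, Complex.norm_real, norm_inv, norm_norm, inv_mul_cancel₀ this]
    refine h f.natDegree ⟨by omega, by omega⟩ (((‖q‖⁻¹ : ℝ) : ℂ) • q) (((‖q'‖⁻¹ : ℝ) : ℂ) • q')
      ⟨hnorm q (by rw [hq]; exact hf.ne_zero), hnorm q' (by rw [hq']; exact hg.ne_zero), ?_⟩
    have hprod : bivariate (((‖q‖⁻¹ : ℝ) : ℂ) • q) * bivariate (((‖q'‖⁻¹ : ℝ) : ℂ) • q') =
        C (C (((‖q‖⁻¹ : ℝ) : ℂ) * ((‖q'‖⁻¹ : ℝ) : ℂ))) * P t := by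
      rw [bivariate_smul, bivariate_smul, hq, hq', ← hfg, C_mul, C_mul]
      ring
    rw [hprod]
    congr 3
    have hlead : (P t).coeff (f.natDegree + (r - f.natDegree)) = 1 := by
      rw [show f.natDegree + (r - f.natDegree) = (P t).natDegree by rw [hdeg]; omega]
      exact hmonic t
    rw [coeff_C_mul, hlead, mul_one, coeff_C_zero]

end

lemma exists_natDegree_eval_C_le (w : ℂ[X][X]) :
    ∃ N : ℕ, ∀ t : ℂ, (w.eval (C t)).natDegree ≤ N := by
  induction w using Polynomial.induction_on' with
  | add P Q hP hQ =>
    obtain ⟨M, hM⟩ := hP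
    obtain ⟨N, hN⟩ := hQ
    refine ⟨max M N, fun t => ?_⟩
    rw [eval_add]
    exact (natDegree_add_le _ _).trans (max_le_max (hM t) (hN t))
  | monomial n a =>
    refine ⟨a.natDegree, fun t => ?_⟩
    rw [eval_monomial, ← C_pow]
    exact natDegree_mul_C_le _ _

lemma isOpen_setOf_line_mem_irr (hr : 0 < r) (A V : MPrime r d) :
    IsOpen {t : ℂ | A + t • V ∈ irr r d} := by
  set W := (A.1.map C + (X : ℂ[X][X]) • V.1.map C).charpoly with hW
  have hP : ∀ t : ℂ, (A + t • V).1.charpoly = W.map (evalRingHom (C t)) := by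
    intro t
    rw [hW, ← Matrix.charpoly_map]
    congr 1
    ext1 i j
    change A.1 i j + t • V.1 i j = _
    simp only [Polynomial.smul_eq_C_mul, Matrix.map_apply, Matrix.add_apply, Matrix.smul_apply,
      smul_eq_mul, coe_evalRingHom, eval_add, eval_mul, eval_X, eval_C]
  choose N hN using fun i => exists_natDegree_eval_C_le (W.coeff i)
  have hdeg : ∀ t : ℂ, (A + t • V).1.charpoly.natDegree = r := fun t => by
    rw [Matrix.charpoly_natDegree_eq_dim, Fintype.card_fin]
  refine isOpen_setOf_irreducible (P := fun t : ℂ => (A + t • V).1.charpoly)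
    (N := ∑ i ∈ Finset.range (r + 1), N i) hr (fun t => Matrix.charpoly_monic _) hdeg ?_ ?_
  · intro t i k hk
    by_cases hi : i < r + 1
    · rw [hP, coeff_map]
      refine coeff_eq_zero_of_natDegree_lt ((hN i t).trans_lt (lt_of_le_of_lt ?_ hk))
      exact Finset.single_le_sum (f := N) (fun _ _ => Nat.zero_le _) (Finset.mem_range.2 hi)
    · have : (A + t • V).1.charpoly.coeff i = 0 :=
        coeff_eq_zero_of_natDegree_lt (by rw [hdeg]; omega)
      rw [this, coeff_zero]
  · intro i k
    obtain ⟨u, hu⟩ := exists_coeff_poly (W.coeff i) k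
    have : ∀ t : ℂ, ((A + t • V).1.charpoly.coeff i).coeff k = u.eval t := fun t => by
      rw [hP, coeff_map, ← hu t]
      rfl
    simp only [this]
    exact u.continuous

/-- The preimage in `M'(r,d)` of an open subset of the phase space. -/
def phaseDomain (V : Opens (PhaseSpace r d)) : Set (MPrime r d) :=
  {A | ∃ h : A ∈ irr r d, Quotient.mk (orbitSetoid r d) ⟨A, h⟩ ∈ V}

lemma exists_opens_phaseDomain (V : Opens (PhaseSpace r d)) :
    ∃ W : Opens (MPrime r d), phaseDomain V = irr r d ∩ W := by
  have hV : IsOpen ((Quotient.mk (orbitSetoid r d)) ⁻¹' (V : Set (PhaseSpace r d))) :=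
    V.2.preimage continuous_quotient_mk'
  obtain ⟨W, hW, hWV⟩ := isOpen_induced_iff.1 hV
  refine ⟨⟨W, hW⟩, ?_⟩
  ext A
  constructor
  · rintro ⟨h, hA⟩
    refine ⟨h, ?_⟩
    have : (⟨A, h⟩ : irr r d) ∈ Subtype.val ⁻¹' W := by rw [hWV]; exact hA
    exact this
  · rintro ⟨h, hA⟩
    refine ⟨h, ?_⟩
    have : (⟨A, h⟩ : irr r d) ∈ Quotient.mk (orbitSetoid r d) ⁻¹' (V : Set (PhaseSpace r d)) := by
      rw [← hWV]; exact hA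
    exact this

lemma lineOpen_phaseDomain (hr : 0 < r) (V : Opens (PhaseSpace r d)) :
    LineOpen (phaseDomain V) := by
  obtain ⟨W, hW⟩ := exists_opens_phaseDomain V
  intro A hA B
  rw [hW] at hA ⊢
  refine tendsto_nhdsWithin_iff.2 ⟨tendsto_line A B, ?_⟩
  have h1 : ∀ᶠ t : ℂ in 𝓝 0, A + t • B ∈ irr r d :=
    (isOpen_setOf_line_mem_irr hr A B).mem_nhds (by simpa using hA.1)
  filter_upwards [h1, (tendsto_line A B).eventually (W.2.mem_nhds hA.2)] with t ht1 ht2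
  exact ⟨ht1, ht2⟩

/-! ### Poisson structures on sheaves of invariant functions -/

/-- A presentation of the sections of a sheaf `F` as the invariant regular functions on line-open
subsets of `M'`. Sections are turned into functions on all of `M'`; only the values on the domain
matter. -/
structure Presentation {X : Type*} [TopologicalSpace X] (F : FunctionSheaf X) (r d : ℕ) where
  dom : Opens X → Set (MPrime r d)
  ext : ∀ U, F.sections U → MPrime r d → ℂ
  lineOpen : ∀ U, LineOpen (dom U)
  dom_mono : ∀ {U V : Opens X}, V ≤ U → dom V ⊆ dom U
  ext_add : ∀ U (f g : F.sections U) A, ext U (f + g) A = ext U f A + ext U g A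
  ext_smul : ∀ U (t : ℂ) (f : F.sections U) A, ext U (t • f) A = t * ext U f A
  ext_mul : ∀ U (f g : F.sections U) A, ext U (f * g) A = ext U f A * ext U g A
  ext_res : ∀ {U V : Opens X} (h : V ≤ U) (f : F.sections U), ∀ A ∈ dom V,
    ext V (F.res h f) A = ext U f A
  ext_inj : ∀ U (f g : F.sections U), (∀ A ∈ dom U, ext U f A = ext U g A) → f = g
  regAt : ∀ U (f : F.sections U), ∀ A ∈ dom U, RegAt (dom U) (ext U f) A
  invOn : ∀ U (f : F.sections U), InvOn (dom U) (ext U f)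
  exists_section : ∀ U (K : MPrime r d → ℂ), (∀ A ∈ dom U, RegAt (dom U) K A) →
    InvOn (dom U) K → ∃ f, ∀ A ∈ dom U, ext U f A = K A

/-- The truncated bracket defines a Poisson structure on a sheaf presented by invariant regular
functions. -/
theorem Presentation.exists_poissonStructure {X : Type*} [TopologicalSpace X]
    {F : FunctionSheaf X} (R : Presentation F r d) {φ : ℂ[X]}
    (hφ : φ ∈ degreeLE ℂ ((d + 2 : ℕ) : WithBot ℕ)) :
    ∃ P : PoissonStructure F, ∀ U (f h : F.sections U), ∀ A ∈ R.dom U,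
      R.ext U (P.bracket U f h) A = bvBracket φ (R.ext U f) (R.ext U h) A := by
  have hex : ∀ U (f h : F.sections U), ∃ k, ∀ A ∈ R.dom U,
      R.ext U k A = bvBracket φ (R.ext U f) (R.ext U h) A := fun U f h =>
    R.exists_section U _
      (fun A hA => (R.regAt U f A hA).bvBracket (R.lineOpen U) φ (R.regAt U h A hA))
      (InvOn.bvBracket (R.lineOpen U) hφ (R.regAt U f) (R.regAt U h) (R.invOn U f) (R.invOn U h))
  choose br hbr using hex
  have hskew : ∀ U f h, br U f h = -br U h f := fun U f h => R.ext_inj U _ _ fun A hA => by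
    rw [← neg_one_smul ℂ (br U h f), R.ext_smul, hbr U f h A hA, hbr U h f A hA, bvBracket_skew]
    ring
  have hadd : ∀ U f g h, br U f (g + h) = br U f g + br U f h := fun U f g h =>
    R.ext_inj U _ _ fun A hA => by
      rw [R.ext_add, hbr U _ _ A hA, hbr U _ _ A hA, hbr U _ _ A hA,
        funext (R.ext_add U g h),
        bvBracket_add_right (R.lineOpen U) hA _ _ (R.regAt U g A hA) (R.regAt U h A hA)]
  have hsmul : ∀ U (t : ℂ) f h, br U f (t • h) = t • br U f h := fun U t f h =>
    R.ext_inj U _ _ fun A hA => by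
      rw [R.ext_smul, hbr U _ _ A hA, hbr U _ _ A hA,
        funext (R.ext_smul U t h), bvBracket_const_mul_right]
  refine ⟨{
    bracket := fun U => LinearMap.mk₂ ℂ (br U)
      (fun f g h => by rw [hskew, hadd, neg_add, ← hskew, ← hskew])
      (fun t f h => by rw [hskew, hsmul, ← smul_neg, ← hskew]) (hadd U) (hsmul U)
    bracket_res := ?_
    skew := hskew
    leibniz := ?_
    jacobi := ?_ }, hbr⟩
  · intro U V h f g
    refine R.ext_inj V _ _ fun A hA => ?_
    rw [R.ext_res h _ A hA]
    refine (hbr U f g A (R.dom_mono h hA)).trans ((hbr V _ _ A hA).trans ?_).symm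
    exact bvBracket_congr (R.lineOpen V) hA φ (R.ext_res h f) (R.ext_res h g)
  · intro U f g h
    refine R.ext_inj U _ _ fun A hA => ?_
    change R.ext U (br U f (g * h)) A = R.ext U (br U f g * h + g * br U f h) A
    rw [R.ext_add, R.ext_mul, R.ext_mul, hbr U _ _ A hA, hbr U _ _ A hA, hbr U _ _ A hA,
      funext (R.ext_mul U g h),
      bvBracket_leibniz (R.lineOpen U) hA φ _ (R.regAt U g A hA) (R.regAt U h A hA)]
  · intro U f g h
    refine R.ext_inj U _ _ fun A hA => ?_
    change R.ext U (br U f (br U g h) + br U g (br U h f) + br U h (br U f g)) A = R.ext U 0 A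
    have h0 : R.ext U 0 A = 0 := by
      rw [← zero_smul ℂ (0 : F.sections U), R.ext_smul, zero_mul]
    have hit : ∀ f g h : F.sections U, R.ext U (br U f (br U g h)) A =
        bvBracket φ (R.ext U f) (bvBracket φ (R.ext U g) (R.ext U h)) A := fun f g h => by
      rw [hbr U _ _ A hA]
      exact bvBracket_congr (R.lineOpen U) hA φ (fun _ _ => rfl) (hbr U g h)
    rw [R.ext_add, R.ext_add, hit, hit, hit, h0]
    exact bvBracket_jacobi (R.lineOpen U) hφ hA (R.regAt U f A hA) (R.regAt U g A hA)
      (R.regAt U h A hA) (R.invOn U f) (R.invOn U g) (R.invOn U h)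

lemma coordBracket_linear_comb (c₁ c₂ : ℂ) (φ₁ φ₂ : ℂ[X]) (a b : Coord r d) (A : MPrime r d) :
    coordBracket (c₁ • φ₁ + c₂ • φ₂) a b A =
      c₁ * coordBracket φ₁ a b A + c₂ * coordBracket φ₂ a b A := by
  have hL : toLaurent (c₁ • φ₁ + c₂ • φ₂) = c₁ • toLaurent φ₁ + c₂ • toLaurent φ₂ :=
    (map_add _ _ _).trans
      (congrArg₂ _ (map_smul (toLaurentAlg (R := ℂ)) c₁ φ₁) (map_smul (toLaurentAlg (R := ℂ)) c₂ φ₂))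
  have hdd : ∀ p : ℂ[X], ∀ m n : ℕ, ((divDiff (c₁ • φ₁ + c₂ • φ₂) p).coeff n).coeff m =
      c₁ * ((divDiff φ₁ p).coeff n).coeff m + c₂ * ((divDiff φ₂ p).coeff n).coeff m := by
    intro p m n
    simp only [coeff_divDiff, hL, kernelCoeff, add_mul, smul_mul_assoc, map_add, map_smul, mul_add,
      mul_sub, mul_smul_comm, AddMonoidAlgebra.coeff_add, AddMonoidAlgebra.coeff_sub,
      AddMonoidAlgebra.coeff_smul, Finsupp.add_apply, Finsupp.sub_apply, Finsupp.smul_apply,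
      smul_eq_mul]
    ring
  simp only [coordBracket, coeff_sub]
  split_ifs <;> simp [hdd] <;> ring

lemma bvBracket_linear_comb (c₁ c₂ : ℂ) (φ₁ φ₂ : ℂ[X]) (F H : MPrime r d → ℂ) (A : MPrime r d) :
    bvBracket (c₁ • φ₁ + c₂ • φ₂) F H A =
      c₁ * bvBracket φ₁ F H A + c₂ * bvBracket φ₂ F H A := by
  simp only [bvBracket, coordBracket_linear_comb, Finset.mul_sum, ← Finset.sum_add_distrib]
  exact Finset.sum_congr rfl fun a _ => Finset.sum_congr rfl fun b _ => by ring

/-! ### The two sheaves -/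

lemma RegAt.exists_opens {D : Set (MPrime r d)} {F : MPrime r d → ℂ} {A : MPrime r d}
    (hF : RegAt D F A) : ∃ W : Opens (MPrime r d), A ∈ W ∧ ∃ p q, ∀ B ∈ D, B ∈ W →
      BV.evalAt B q ≠ 0 ∧ F B = BV.evalAt B p / BV.evalAt B q := by
  obtain ⟨p, q, h⟩ := hF
  obtain ⟨W, hW, hAW, hWD⟩ := mem_nhdsWithin.1 h
  exact ⟨⟨W, hW⟩, hAW, p, q, fun B hB hBW => hWD ⟨hBW, hB⟩⟩

section ExtendZero

variable {X : Type*} {U : Set X}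

lemma extendZero_of_mem (f : U → ℂ) {a : X} (h : a ∈ U) : extendZero f a = f ⟨a, h⟩ := dif_pos h

lemma extendZero_of_notMem (f : U → ℂ) {a : X} (h : a ∉ U) : extendZero f a = 0 := dif_neg h

lemma extendZero_add (f g : U → ℂ) (a : X) :
    extendZero (f + g) a = extendZero f a + extendZero g a := by
  unfold extendZero; split_ifs <;> simp

lemma extendZero_mul (f g : U → ℂ) (a : X) :
    extendZero (f * g) a = extendZero f a * extendZero g a := by
  unfold extendZero; split_ifs <;> simp

lemma extendZero_smul (t : ℂ) (f : U → ℂ) (a : X) :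
    extendZero (t • f) a = t * extendZero f a := by
  unfold extendZero; split_ifs <;> simp

end ExtendZero

lemma mem_invariantSheaf {U : Opens (MPrime r d)} {K : MPrime r d → ℂ}
    (hK : ∀ A ∈ (U : Set (MPrime r d)), RegAt U K A) (hinv : InvOn U K) :
    (fun A : U => K A.1) ∈ (invariantSheaf r d).sections U := by
  refine ⟨fun a => ?_, fun g A B h => ?_⟩
  · obtain ⟨W, haW, p, q, h⟩ := (hK a.1 a.2).exists_opens
    exact ⟨W, haW, p, q, fun b hb => h b.1 b.2 hb⟩
  · have := hinv g A.1 A.2 (h ▸ B.2)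
    rwa [← h] at this

/-- Invariant regular functions on open subsets of `M'`, extended by zero. -/
def invariantPresentation (r d : ℕ) : Presentation (invariantSheaf r d) r d where
  dom U := U
  ext U f := extendZero f.1
  lineOpen U := LineOpen.of_isOpen U.2
  dom_mono h := h
  ext_add U f g := extendZero_add f.1 g.1
  ext_smul U t f := extendZero_smul t f.1
  ext_mul U f g := extendZero_mul f.1 g.1
  ext_res h f A hA := by
    rw [extendZero_of_mem _ hA, extendZero_of_mem _ (h hA)]
    rfl
  ext_inj U f g h := Subtype.ext (funext fun A => by
    have := h A.1 A.2
    rwa [extendZero_of_mem _ A.2, extendZero_of_mem _ A.2] at this)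
  regAt U f A hA := by
    obtain ⟨W, hAW, p, q, h⟩ := f.2.1 ⟨A, hA⟩
    refine ⟨p, q, ?_⟩
    filter_upwards [self_mem_nhdsWithin, mem_nhdsWithin_of_mem_nhds (W.2.mem_nhds hAW)]
      with B hB hBW
    rw [extendZero_of_mem _ hB]
    exact h ⟨B, hB⟩ hBW
  invOn U f g A hA hgA := by
    rw [extendZero_of_mem _ hA, extendZero_of_mem _ hgA]
    exact f.2.2 g ⟨A, hA⟩ ⟨_, hgA⟩ rfl
  exists_section U K hK hinv :=
    ⟨⟨_, mem_invariantSheaf hK hinv⟩, fun A hA => extendZero_of_mem _ hA⟩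

lemma pullback_of_mem {V : Opens (PhaseSpace r d)} (f : V → ℂ) {A : MPrime r d}
    (h : A ∈ irr r d) (hA : Quotient.mk (orbitSetoid r d) ⟨A, h⟩ ∈ V) :
    pullback f A = f ⟨_, hA⟩ := by
  rw [pullback, extendZero_of_mem _ h]
  exact extendZero_of_mem _ hA

lemma pullback_binary {V : Opens (PhaseSpace r d)} (f g k : V → ℂ) (op : ℂ → ℂ → ℂ)
    (h0 : op 0 0 = 0) (hk : ∀ v, k v = op (f v) (g v)) (A : MPrime r d) :
    pullback k A = op (pullback f A) (pullback g A) := by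
  by_cases h : A ∈ irr r d
  · by_cases hA : Quotient.mk (orbitSetoid r d) ⟨A, h⟩ ∈ V
    · rw [pullback_of_mem _ h hA, pullback_of_mem _ h hA, pullback_of_mem _ h hA, hk]
    · have : ∀ f : V → ℂ, pullback f A = 0 := fun f => by
        rw [pullback, extendZero_of_mem _ h]
        exact extendZero_of_notMem _ hA
      rw [this, this, this, h0]
  · simp only [pullback, extendZero_of_notMem _ h, h0]

/-- An invariant regular function on the preimage of `V` descends to a section over `V`. -/
lemma mem_phaseSheaf {V : Opens (PhaseSpace r d)} {K : MPrime r d → ℂ}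
    (hK : ∀ A ∈ phaseDomain V, RegAt (phaseDomain V) K A) {k : V → ℂ}
    (hk : ∀ (A : irr r d) (hA : Quotient.mk (orbitSetoid r d) A ∈ V), k ⟨_, hA⟩ = K A.1) :
    k ∈ (phaseSheaf r d).sections V := by
  intro a
  obtain ⟨W, haW, p, q, h⟩ := (hK a.1.1 ⟨a.1.2, a.2⟩).exists_opens
  have haq := (h a.1.1 ⟨a.1.2, a.2⟩ haW).1
  refine ⟨W ⊓ ⟨_, isOpen_evalAt_ne q⟩, fun B => evalAt B.1 p / evalAt B.1 q, ?_, ⟨haW, haq⟩, ?_⟩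
  · exact fun b => ⟨⟨_, isOpen_evalAt_ne q⟩, b.2.2, p, q, fun c _ => ⟨c.2.2, rfl⟩⟩
  · intro b hb
    exact (hk b.1 b.2).trans (h b.1.1 ⟨b.1.2, b.2⟩ hb.1).2

/-- Sections over an open subset of the phase space, pulled back to `M'`. -/
def phasePresentation (hr : 0 < r) (d : ℕ) : Presentation (phaseSheaf r d) r d where
  dom V := phaseDomain V
  ext V f := pullback f.1
  lineOpen V := lineOpen_phaseDomain hr V
  dom_mono h A := fun ⟨hA, hV⟩ => ⟨hA, h hV⟩
  ext_add V f g := pullback_binary f.1 g.1 _ (· + ·) (add_zero 0) fun _ => rfl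
  ext_smul V t f := pullback_binary f.1 f.1 _ (fun x _ => t * x) (mul_zero t) fun _ => rfl
  ext_mul V f g := pullback_binary f.1 g.1 _ (· * ·) (mul_zero 0) fun _ => rfl
  ext_res h f A := fun ⟨hA, hV⟩ => by
    rw [pullback_of_mem _ hA hV, pullback_of_mem _ hA (h hV)]
    rfl
  ext_inj V f g h := Subtype.ext (funext fun ⟨v, hv⟩ => by
    induction v using Quotient.inductionOn with
    | h A =>
      have := h A.1 ⟨A.2, hv⟩
      rwa [pullback_of_mem _ A.2 hv, pullback_of_mem _ A.2 hv] at this)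
  regAt V f A := fun ⟨hA, hV⟩ => by
    obtain ⟨W, s, hs, hAW, hfs⟩ := f.2 ⟨⟨A, hA⟩, hV⟩
    obtain ⟨W', hAW', p, q, h⟩ := hs ⟨A, hAW⟩
    refine ⟨p, q, ?_⟩
    filter_upwards [self_mem_nhdsWithin, mem_nhdsWithin_of_mem_nhds (W.2.mem_nhds hAW),
      mem_nhdsWithin_of_mem_nhds (W'.2.mem_nhds hAW')] with B hB hBW hBW'
    obtain ⟨hB, hBV⟩ := hB
    rw [pullback_of_mem _ hB hBV]
    have h1 := h ⟨B, hBW⟩ hBW'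
    exact ⟨h1.1, (hfs ⟨⟨B, hB⟩, hBV⟩ hBW).trans h1.2⟩
  invOn V f g A := fun ⟨hA, hV⟩ ⟨hgA, hgV⟩ => by
    rw [pullback_of_mem _ hA hV, pullback_of_mem _ hgA hgV]
    refine congrArg f.1 (Subtype.ext ?_)
    exact (Quotient.sound (s := orbitSetoid r d) (a := ⟨A, hA⟩) (b := ⟨conj g A, hgA⟩)
      ⟨g, rfl⟩).symm
  exists_section V K hK hinv := by
    have hk : ∀ (A : irr r d) (hA : Quotient.mk (orbitSetoid r d) A ∈ V),
        K (Quotient.out (Quotient.mk (orbitSetoid r d) A)).1 = K A.1 := by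
      intro A hA
      obtain ⟨g, hg⟩ : (orbitSetoid r d).r (Quotient.out (Quotient.mk (orbitSetoid r d) A)) A :=
        Quotient.mk_out A
      rw [hg]
      refine (hinv g _ ⟨Subtype.prop _, ?_⟩ ?_).symm
      · rw [Subtype.coe_eta, Quotient.out_eq]
        exact hA
      · rw [← hg]
        exact ⟨A.2, hA⟩
    exact ⟨⟨fun v => K (Quotient.out v.1).1, mem_phaseSheaf hK hk⟩, fun A ⟨hA, hV⟩ =>
      (pullback_of_mem _ hA hV).trans (hk ⟨A, hA⟩ hV)⟩

end BV

end

theorem proposition3 (r d : ℕ) (hr : 2 ≤ r) (hd : 1 ≤ d) :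
    -- the sheaf of invariant functions is closed under the truncated bracket, which is a
    -- Poisson algebra structure on it
    (∀ φ : Polynomial.degreeLE ℂ ((d + 2 : ℕ) : WithBot ℕ),
      (∀ (U : TopologicalSpace.Opens (BV.MPrime r d))
          (f h : (BV.invariantSheaf r d).sections U),
        (fun A : U => BV.bvBracket φ.1 (BV.extendZero f.1) (BV.extendZero h.1) A.1) ∈
          (BV.invariantSheaf r d).sections U) ∧
      ∃ P : BV.PoissonStructure (BV.invariantSheaf r d),
        ∀ (U : TopologicalSpace.Opens (BV.MPrime r d))
          (f h : (BV.invariantSheaf r d).sections U) (A : U),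
          (P.bracket U f h).1 A =
            BV.bvBracket φ.1 (BV.extendZero f.1) (BV.extendZero h.1) A.1) ∧
    -- the induced family of compatible Poisson structures on the phase space
    ∃ P : Polynomial.degreeLE ℂ ((d + 2 : ℕ) : WithBot ℕ) →
        BV.PoissonStructure (BV.phaseSheaf r d),
      (∀ φ (V : TopologicalSpace.Opens (BV.PhaseSpace r d))
          (f h : (BV.phaseSheaf r d).sections V) (A : BV.irr r d)
          (hA : Quotient.mk (BV.orbitSetoid r d) A ∈ V),
          ((P φ).bracket V f h).1 ⟨Quotient.mk (BV.orbitSetoid r d) A, hA⟩ =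
            BV.bvBracket φ.1 (BV.pullback f.1) (BV.pullback h.1) A.1) ∧
      ∀ (c₁ c₂ : ℂ) (φ₁ φ₂ : Polynomial.degreeLE ℂ ((d + 2 : ℕ) : WithBot ℕ))
          (V : TopologicalSpace.Opens (BV.PhaseSpace r d))
          (f h : (BV.phaseSheaf r d).sections V),
        (P (c₁ • φ₁ + c₂ • φ₂)).bracket V f h =
          c₁ • (P φ₁).bracket V f h + c₂ • (P φ₂).bracket V f h := by
  refine ⟨fun φ => ⟨fun U f h => ?_, ?_⟩, ?_⟩
  · let R := BV.invariantPresentation r d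
    exact BV.mem_invariantSheaf
      (fun A hA => (R.regAt U f A hA).bvBracket (R.lineOpen U) φ.1 (R.regAt U h A hA))
      (BV.InvOn.bvBracket (R.lineOpen U) φ.2 (R.regAt U f) (R.regAt U h) (R.invOn U f)
        (R.invOn U h))
  · obtain ⟨P, hP⟩ := (BV.invariantPresentation r d).exists_poissonStructure φ.2
    exact ⟨P, fun U f h A => (BV.extendZero_of_mem _ A.2).symm.trans (hP U f h A.1 A.2)⟩
  · let R := BV.phasePresentation (by omega : 0 < r) d
    choose P hP using fun φ : Polynomial.degreeLE ℂ ((d + 2 : ℕ) : WithBot ℕ) =>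
      R.exists_poissonStructure φ.2
    refine ⟨P, fun φ V f h A hA => ?_, fun c₁ c₂ φ₁ φ₂ V f h => ?_⟩
    · exact (BV.pullback_of_mem _ A.2 hA).symm.trans (hP φ V f h A.1 ⟨A.2, hA⟩)
    · refine R.ext_inj V _ _ fun A hA => ?_
      rw [R.ext_add, R.ext_smul, R.ext_smul, hP _ V f h A hA, hP _ V f h A hA, hP _ V f h A hA]
      exact BV.bvBracket_linear_comb c₁ c₂ φ₁.1 φ₂.1 _ _ A
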